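/- Let $d,r\in\mathbb N$ and $\Omega=\{-1,1\}^{\mathbb Z^d}$ with the product topology and the pointwise order; for $\sigma\in\Omega$ let $\sigma^x$ be $\sigma$ with the spin at $x$ flipped. Rates of range $r$ are a family $c=(c_x)_{x\in\mathbb Z^d}$ of functions $c_x:\Omega\to[0,\infty)$ with $\sup_{x,\sigma}c_x(\sigma)<\infty$ such that $c_x(\sigma)=c_x(\sigma')$ whenever $\sigma(y)=\sigma'(y)$ for all $y$ with $|y-x|_\infty\le r$. The spin-flip process with rates $c$ is the Feller process on $\Omega$ whose generator is given on cylinder functions (functions of finitely many spins) by $Lf(\sigma)=\sum_x c_x(\sigma)\,(f(\sigma^x)-f(\sigma))$; let $\mathbb E_\sigma(f_t)$ be the expectation of $f$ at time $t$ for this process started from $\sigma$. The process is called exponentially $L^\infty$-mixing if it has a unique stationary probability measure $\mu$ and there are $a>0$ and constants $C(f)$ such that, for all cylinder functions $f$ and all $t\ge 0$, $$\sup_{\sigma\in\Omega}\bigl|\mathbb E_{\sigma}(f_t)-\mu(f)\bigr|\le C(f)\,e^{-at},$$ where $C(f)=C(\tau_xf)$ for every translate $\tau_xf$, $x\in\mathbb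 Z^d$, of $f$. Theorem. Let $c^0$ be rates of range $r$ that are attractive: if $\sigma\ge\sigma'$, then $c^0_x(\sigma)\ge c^0_x(\sigma')$ when $\sigma(x)=\sigma'(x)=-1$, and $c^0_x(\sigma)\le c^0_x(\sigma')$ when $\sigma(x)=\sigma'(x)=1$. Suppose that the spin-flip process with rates $c^0$ is exponentially $L^\infty$-mixing. Then there is $\varepsilon>0$ (depending on $d$, $r$ and $c^0$) such that, for all rates $c^1$ of range $r$ with $\sup_{x,\sigma}|c^0_x(\sigma)-c^1_x(\sigma)|\le\varepsilon$, not necessarily attractive or reversible, the spin-flip process with rates $c^1$ is exponentially $L^\infty$-mixing. In particular, it has a unique stationary probability measure. -/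

import Mathlib

open MeasureTheory ProbabilityTheory Filter Topology
open scoped NNReal

namespace SpinFlip

/-- The lattice `ℤ^d`. -/
abbrev Site (d : ℕ) : Type := Fin d → ℤ

/-- The configuration space `Ω = {-1, 1}^{ℤ^d}`, with `ℤˣ = {1, -1}` as the spin space. It carries
the product topology, the product σ-algebra (which is its Borel σ-algebra) and the pointwise
partial order. -/
abbrev Config (d : ℕ) : Type := Site d → ℤˣ

/-- The σ-algebra on the two-point spin space is the discrete one. -/
instance : DiscreteMeasurableSpace ℤˣ :=
  ⟨fun s => ⟨Units.val '' s, trivial, Set.preimage_image_eq s Units.val_injective⟩⟩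

/-- The configuration `σ^x`, i.e. `σ` with the spin at `x` flipped. -/
def flip {d : ℕ} (x : Site d) (σ : Config d) : Config d :=
  Function.update σ x (-σ x)

/-- The configuration `σ` shifted by `x`. -/
def shift {d : ℕ} (x : Site d) (σ : Config d) : Config d :=
  fun y => σ (y + x)

/-- A cylinder function depends on finitely many spins only. -/
def IsCylinder {d : ℕ} (f : Config d → ℝ) : Prop :=
  ∃ X : Finset (Site d), DependsOn f (X : Set (Site d))

/-- The ball of radius `r` around `x` in the `ℓ^∞`-distance of `ℤ^d`. -/
def ball {d : ℕ} (r : ℕ) (x : Site d) : Set (Site d) :=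
  {y | ∀ i, |y i - x i| ≤ (r : ℤ)}

/-- `c x σ` is the rate at which the spin at `x` flips in the configuration `σ`. The rates are
nonnegative, of range `r`, and uniformly bounded. -/
structure IsRates {d : ℕ} (r : ℕ) (c : Site d → Config d → ℝ) : Prop where
  nonneg : ∀ x σ, 0 ≤ c x σ
  finite_range : ∀ x, DependsOn (c x) (ball r x)
  bounded : ∃ K : ℝ, ∀ x σ, c x σ ≤ K

/-- Attractive rates. -/
def Attractive {d : ℕ} (c : Site d → Config d → ℝ) : Prop :=
  ∀ σ σ' : Config d, σ' ≤ σ → ∀ x,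
    (σ x = -1 → σ' x = -1 → c x σ' ≤ c x σ) ∧
    (σ x = 1 → σ' x = 1 → c x σ ≤ c x σ')

/-- The generator `L f (σ) = ∑_x c_x(σ) (f(σ^x) - f(σ))`. It is applied to cylinder functions,
for which all but finitely many terms vanish. -/
noncomputable def generator {d : ℕ} (c : Site d → Config d → ℝ) (f : Config d → ℝ)
    (σ : Config d) : ℝ :=
  ∑' x, c x σ * (f (flip x σ) - f σ)

/-- `P` is the family of transition kernels of the Feller process on `Ω` generated by the rates
`c`: `P t σ` is the law at time `t` of the process started from `σ`, so that
`∫ η, f η ∂(P t σ)` is `𝔼_σ (f_t)`. The infinitesimal generator of the Feller semigroup extends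
`generator c` on cylinder functions. -/
structure IsSpinFlipProcess {d : ℕ} (c : Site d → Config d → ℝ)
    (P : ℝ≥0 → Kernel (Config d) (Config d)) : Prop where
  markov : ∀ t, IsMarkovKernel (P t)
  zero : P 0 = Kernel.id
  add : ∀ s t, P (s + t) = P t ∘ₖ P s
  feller : ∀ t (f : C(Config d, ℝ)), Continuous fun σ => ∫ η, f η ∂(P t σ)
  strongly_continuous : ∀ f : C(Config d, ℝ),
    TendstoUniformly (fun (t : ℝ≥0) σ => ∫ η, f η ∂(P t σ)) f (𝓝 0)
  generator_eq : ∀ f : Config d → ℝ, IsCylinder f →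
    TendstoUniformly (fun (t : ℝ≥0) σ => (t : ℝ)⁻¹ * ((∫ η, f η ∂(P t σ)) - f σ))
      (generator c f) (𝓝[>] 0)

/-- `μ` is an invariant (stationary) state of the Markov process with transition kernels `P`. -/
def IsStationary {d : ℕ} (P : ℝ≥0 → Kernel (Config d) (Config d))
    (μ : Measure (Config d)) : Prop :=
  IsProbabilityMeasure μ ∧ ∀ t, (P t).Invariant μ

/-- Exponentially fast `L^∞`-mixing: there is a unique invariant state `μ`, and, for all cylinder
functions `f`, `sup_σ |𝔼_σ (f_t) - μ(f)| ≤ C(f) e^{-a t}` with a rate `a > 0` that does not depend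
on `f` and a constant `C(f)` that is invariant under translations of `f`. -/
def ExpMixing {d : ℕ} (P : ℝ≥0 → Kernel (Config d) (Config d)) : Prop :=
  ∃ μ : Measure (Config d),
    (IsStationary P μ ∧ ∀ ν, IsStationary P ν → ν = μ) ∧
    ∃ a : ℝ, 0 < a ∧ ∃ C : (Config d → ℝ) → ℝ,
      (∀ f, IsCylinder f → ∀ x, C (fun σ => f (shift x σ)) = C f) ∧
      ∀ f, IsCylinder f → ∀ (t : ℝ≥0) (σ : Config d),
        |(∫ η, f η ∂(P t σ)) - ∫ η, f η ∂μ| ≤ C f * Real.exp (-(a * t))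

end SpinFlip

/-!
The argument passes from the infinite-volume continuous-time process to a finite-volume
discrete-time one, for which couplings and monotonicity are elementary inductions.

Flipping with rates `c` is the same as resampling each spin at a constant rate `κ`, the new spin at
`x` being `1` with probability `heatBath κ c x σ`. For `κ ≥ 2 sup c` this probability is increasing
in `σ` exactly when `c` is attractive. If only the spins in a finite volume are resampled, and time
is discretized, one gets the Markov operator `step`. Its powers converge to the semigroup of the
process (`IsSpinFlipProcess.eventually_abs_expect_sub_step_pow_le`): by finite speed of
propagation, freezing the spins outside a large volume has little effect on a cylinder function,
and in a fixed finite volume the generator controls all difference quotients uniformly.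

Two copies of the discretized dynamics that use the same randomness (`pairStep`) yield the bound
`osc_y(f_t) ≤ ∑ x, osc_x(f) γ(x, y)`, where `γ(x, y)` is the probability that a discrepancy at `y`
at time `0` causes one at `x` at time `t`. This probability is bounded in two ways.
* For all rates, it is at most `e^{M t - 2 |x - y|}` (`pairStep_pow_disc_le`).
* If the rates are `ε`-close to the attractive rates `c₀`, it is at most
  `𝔼⁰_{σ ⊔ τ} - 𝔼⁰_{σ ⊓ τ}` of the indicator of a plus spin at `x` at time `t`, plus `O(ε)` for
  fixed `t` (`pairStep_pow_disc_le_attractive`). By mixing, the difference is `O(e^{-a t})`,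
  uniformly in `x`.

Fix a large time `t`. For `|x - y| ≤ b t`, with `b` large, the second bound gives a total
contribution of order `t ^ d (e^{-a t} + O(ε))`, and the other `y` contribute at most `O(e^{-t})` by
the first. So `∑ y, γ(x, y) ≤ 1 / 2` for `ε` small enough (`exists_time_influence`). This step needs
mixing at one time only, which is why the condition is stable under perturbations. The semigroup of
the perturbed process at time `t` then halves the total oscillation `∑ x, osc_x(f)`, and iteration
gives exponential decay, with a constant that is invariant under translations of `f`. A stationary
measure exists by compactness.
-/

namespace SpinFlip

variable {d : ℕ}

/-! ### Heat-bath updates and the discretized finite-volume dynamics -/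

/-- Resampling of the spin at `x`: it becomes `1` with probability `p x σ` and `-1` otherwise. -/
noncomputable def resample (p : Site d → Config d → ℝ) (x : Site d) :
    (Config d → ℝ) →ₗ[ℝ] (Config d → ℝ) where
  toFun f σ := p x σ * f (Function.update σ x 1) + (1 - p x σ) * f (Function.update σ x (-1))
  map_add' f g := by ext σ; simp only [Pi.add_apply]; ring
  map_smul' a f := by
    ext σ; simp only [Pi.smul_apply, smul_eq_mul, RingHom.id_apply]; ring

/-- One time step of length `h` of the dynamics in the finite volume `Λ`: with probability `h` for
each `x ∈ Λ`, the spin at `x` is resampled. The spins outside `Λ` are frozen. -/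
noncomputable def step (p : Site d → Config d → ℝ) (Λ : Finset (Site d)) (h : ℝ) :
    (Config d → ℝ) →ₗ[ℝ] (Config d → ℝ) :=
  LinearMap.id + h • ∑ x ∈ Λ, (resample p x - LinearMap.id)

/-- Resampling of the spin at `x` in two configurations with the same uniform random variable,
which is the coupling that minimizes the probability of a discrepancy at `x`. -/
noncomputable def pairResample (p : Site d → Config d → ℝ) (x : Site d) :
    (Config d → Config d → ℝ) →ₗ[ℝ] (Config d → Config d → ℝ) where
  toFun Ψ σ τ :=
    min (p x σ) (p x τ) * Ψ (Function.update σ x 1) (Function.update τ x 1)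
    + (1 - max (p x σ) (p x τ)) * Ψ (Function.update σ x (-1)) (Function.update τ x (-1))
    + (p x σ - min (p x σ) (p x τ)) * Ψ (Function.update σ x 1) (Function.update τ x (-1))
    + (p x τ - min (p x σ) (p x τ)) * Ψ (Function.update σ x (-1)) (Function.update τ x 1)
  map_add' f g := by ext σ; simp only [Pi.add_apply]; ring
  map_smul' a f := by
    ext σ; simp only [Pi.smul_apply, smul_eq_mul, RingHom.id_apply]; ring

/-- One time step of two copies of the finite-volume dynamics that are driven by the same
randomness. -/
noncomputable def pairStep (p : Site d → Config d → ℝ) (Λ : Finset (Site d)) (h : ℝ) :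
    (Config d → Config d → ℝ) →ₗ[ℝ] (Config d → Config d → ℝ) :=
  LinearMap.id + h • ∑ x ∈ Λ, (pairResample p x - LinearMap.id)

/-- The indicator of a discrepancy at `x` between two configurations. -/
noncomputable def disc (x : Site d) (σ τ : Config d) : ℝ := if σ x = τ x then 0 else 1

/-- The indicator of a plus spin at `x`. -/
noncomputable def plus (x : Site d) (σ : Config d) : ℝ := if σ x = 1 then 1 else 0

lemma disc_nonneg (x : Site d) (σ τ : Config d) : 0 ≤ disc x σ τ := by
  unfold disc; split_ifs <;> norm_num

lemma resample_apply (p : Site d → Config d → ℝ) (x : Site d) (f : Config d → ℝ) (σ : Config d) :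
    resample p x f σ =
      p x σ * f (Function.update σ x 1) + (1 - p x σ) * f (Function.update σ x (-1)) := rfl

lemma pairResample_apply (p : Site d → Config d → ℝ) (x : Site d) (Ψ : Config d → Config d → ℝ)
    (σ τ : Config d) : pairResample p x Ψ σ τ =
    min (p x σ) (p x τ) * Ψ (Function.update σ x 1) (Function.update τ x 1)
    + (1 - max (p x σ) (p x τ)) * Ψ (Function.update σ x (-1)) (Function.update τ x (-1))
    + (p x σ - min (p x σ) (p x τ)) * Ψ (Function.update σ x 1) (Function.update τ x (-1))
    + (p x τ - min (p x σ) (p x τ)) * Ψ (Function.update σ x (-1)) (Function.update τ x 1) := rfl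

lemma step_apply (p : Site d → Config d → ℝ) (Λ : Finset (Site d)) (h : ℝ) (f : Config d → ℝ)
    (σ : Config d) :
    step p Λ h f σ = f σ + h * ∑ x ∈ Λ, (resample p x f σ - f σ) := by
  simp [step]

lemma step_apply' (p : Site d → Config d → ℝ) (Λ : Finset (Site d)) (h : ℝ) (f : Config d → ℝ)
    (σ : Config d) :
    step p Λ h f σ = (1 - h * Λ.card) * f σ + h * ∑ x ∈ Λ, resample p x f σ := by
  rw [step_apply, Finset.sum_sub_distrib, Finset.sum_const, nsmul_eq_mul]; ring

lemma pairStep_apply (p : Site d → Config d → ℝ) (Λ : Finset (Site d)) (h : ℝ)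
    (Ψ : Config d → Config d → ℝ) (σ τ : Config d) :
    pairStep p Λ h Ψ σ τ = Ψ σ τ + h * ∑ x ∈ Λ, (pairResample p x Ψ σ τ - Ψ σ τ) := by
  simp [pairStep]

lemma pairStep_apply' (p : Site d → Config d → ℝ) (Λ : Finset (Site d)) (h : ℝ)
    (Ψ : Config d → Config d → ℝ) (σ τ : Config d) :
    pairStep p Λ h Ψ σ τ = (1 - h * Λ.card) * Ψ σ τ + h * ∑ x ∈ Λ, pairResample p x Ψ σ τ := by
  rw [pairStep_apply, Finset.sum_sub_distrib, Finset.sum_const, nsmul_eq_mul]; ring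

/-- `p x σ` is a probability for all `x` and `σ`. -/
def IsProb (p : Site d → Config d → ℝ) : Prop := ∀ x σ, 0 ≤ p x σ ∧ p x σ ≤ 1

section dynamics

variable {p : Site d → Config d → ℝ} {Λ : Finset (Site d)} {h : ℝ}

lemma pairResample_mono (hp : IsProb p) (x : Site d) {Ψ Φ : Config d → Config d → ℝ}
    (hle : Ψ ≤ Φ) : pairResample p x Ψ ≤ pairResample p x Φ := by
  intro σ τ
  have h1 := le_min (hp x σ).1 (hp x τ).1
  have h2 := max_le (hp x σ).2 (hp x τ).2
  have h3 := min_le_left (p x σ) (p x τ)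
  have h4 := min_le_right (p x σ) (p x τ)
  rw [pairResample_apply, pairResample_apply]
  gcongr <;> first | linarith | exact hle _ _

lemma pairStep_mono (hp : IsProb p) (h0 : 0 ≤ h) (h1 : h * Λ.card ≤ 1)
    {Ψ Φ : Config d → Config d → ℝ} (hle : Ψ ≤ Φ) :
    pairStep p Λ h Ψ ≤ pairStep p Λ h Φ := by
  intro σ τ
  rw [pairStep_apply', pairStep_apply']
  have h2 : 0 ≤ 1 - h * Λ.card := by linarith
  gcongr with x
  · exact hle σ τ
  · exact pairResample_mono hp x hle σ τ

lemma pairStep_pow_mono (hp : IsProb p) (h0 : 0 ≤ h) (h1 : h * Λ.card ≤ 1)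
    {Ψ Φ : Config d → Config d → ℝ} (hle : Ψ ≤ Φ) (n : ℕ) :
    (pairStep p Λ h ^ n) Ψ ≤ (pairStep p Λ h ^ n) Φ := by
  induction n with
  | zero => simpa
  | succ n ih =>
    rw [pow_succ', Module.End.mul_apply, Module.End.mul_apply]
    exact pairStep_mono hp h0 h1 ih

lemma pairResample_sub (x : Site d) (f : Config d → ℝ) :
    pairResample p x (fun σ τ => f σ - f τ) = fun σ τ => resample p x f σ - resample p x f τ := by
  ext σ τ
  simp only [pairResample_apply, resample_apply]
  have := min_add_max (p x σ) (p x τ)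
  have h2 : max (p x σ) (p x τ) = p x σ + p x τ - min (p x σ) (p x τ) := by linarith
  rw [h2]; ring

lemma pairStep_sub (f : Config d → ℝ) :
    pairStep p Λ h (fun σ τ => f σ - f τ) = fun σ τ => step p Λ h f σ - step p Λ h f τ := by
  ext σ τ
  rw [pairStep_apply', step_apply', step_apply']
  simp only [pairResample_sub, Finset.sum_sub_distrib]
  ring

lemma pairStep_pow_sub (f : Config d → ℝ) (n : ℕ) :
    (pairStep p Λ h ^ n) (fun σ τ => f σ - f τ) =
      fun σ τ => (step p Λ h ^ n) f σ - (step p Λ h ^ n) f τ := by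
  induction n with
  | zero => simp
  | succ n ih =>
    simp only [pow_succ', Module.End.mul_apply]
    rw [ih, pairStep_sub]

/-- The two marginals of the coupled dynamics are the dynamics, so a bound on `|f σ - f τ|` by a
function of the pair propagates in time. -/
lemma abs_step_pow_sub_le (hp : IsProb p) (h0 : 0 ≤ h) (h1 : h * Λ.card ≤ 1) {f : Config d → ℝ}
    {Ψ : Config d → Config d → ℝ} (hf : ∀ σ τ, |f σ - f τ| ≤ Ψ σ τ) (n : ℕ) (σ τ : Config d) :
    |(step p Λ h ^ n) f σ - (step p Λ h ^ n) f τ| ≤ (pairStep p Λ h ^ n) Ψ σ τ := by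
  rw [abs_le]
  have hu := pairStep_pow_mono (p := p) (Λ := Λ) (h := h) hp h0 h1
    (Ψ := fun σ τ => f σ - f τ) (Φ := Ψ) (fun σ τ => (abs_le.1 (hf σ τ)).2) n σ τ
  have hl := pairStep_pow_mono (p := p) (Λ := Λ) (h := h) hp h0 h1
    (Ψ := -Ψ) (Φ := fun σ τ => f σ - f τ) (fun σ τ => (abs_le.1 (hf σ τ)).1) n σ τ
  rw [pairStep_pow_sub] at hu hl
  rw [map_neg] at hl
  exact ⟨hl, hu⟩

lemma resample_mono_config (hp : IsProb p) (hmono : ∀ x, Monotone (p x)) (x : Site d)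
    {f : Config d → ℝ} (hf : Monotone f) : Monotone (resample p x f) := by
  intro σ τ hle
  simp only [resample_apply]
  have e1 := hf (update_le_update_iff.2 ⟨le_refl (1 : ℤˣ), fun j _ => hle j⟩ :
    Function.update σ x 1 ≤ Function.update τ x 1)
  have e2 := hf (update_le_update_iff.2 ⟨le_refl (-1 : ℤˣ), fun j _ => hle j⟩ :
    Function.update σ x (-1) ≤ Function.update τ x (-1))
  have e3 := hf (update_le_update_iff.2 ⟨by decide, fun j _ => le_refl _⟩ :
    Function.update τ x (-1) ≤ Function.update τ x 1)
  have := hmono x hle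
  nlinarith [mul_nonneg (hp x σ).1 (sub_nonneg.2 e1),
    mul_nonneg (sub_nonneg.2 (hp x σ).2) (sub_nonneg.2 e2),
    mul_nonneg (sub_nonneg.2 this) (sub_nonneg.2 e3)]

lemma step_mono_config (hp : IsProb p) (hmono : ∀ x, Monotone (p x)) (h0 : 0 ≤ h)
    (h1 : h * Λ.card ≤ 1) {f : Config d → ℝ} (hf : Monotone f) : Monotone (step p Λ h f) := by
  intro σ τ hle
  rw [step_apply', step_apply']
  have h2 : 0 ≤ 1 - h * Λ.card := by linarith
  gcongr with x
  · exact hf hle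
  · exact resample_mono_config hp hmono x hf hle

/-- Attractiveness: the dynamics preserves increasing functions. -/
lemma step_pow_mono_config (hp : IsProb p) (hmono : ∀ x, Monotone (p x)) (h0 : 0 ≤ h)
    (h1 : h * Λ.card ≤ 1) {f : Config d → ℝ} (hf : Monotone f) (n : ℕ) :
    Monotone ((step p Λ h ^ n) f) := by
  induction n with
  | zero => simpa
  | succ n ih =>
    rw [pow_succ', Module.End.mul_apply]
    exact step_mono_config hp hmono h0 h1 ih

lemma abs_step_le (hp : IsProb p) (h0 : 0 ≤ h) (h1 : h * Λ.card ≤ 1) {f : Config d → ℝ} {B : ℝ}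
    (hf : ∀ σ, |f σ| ≤ B) (σ : Config d) : |step p Λ h f σ| ≤ B := by
  rw [step_apply']
  have hr : ∀ x, |resample p x f σ| ≤ B := by
    intro x
    rw [resample_apply, abs_le]
    have a1 := abs_le.1 (hf (Function.update σ x 1))
    have a2 := abs_le.1 (hf (Function.update σ x (-1)))
    have := hp x σ
    constructor <;> nlinarith
  have h2 : 0 ≤ 1 - h * Λ.card := by linarith
  calc _ ≤ |(1 - h * Λ.card) * f σ| + |h * ∑ x ∈ Λ, resample p x f σ| := abs_add_le _ _
    _ ≤ (1 - h * Λ.card) * B + h * (Λ.card * B) := by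
      rw [abs_mul, abs_mul, abs_of_nonneg h2, abs_of_nonneg h0]
      have : |∑ x ∈ Λ, resample p x f σ| ≤ Λ.card * B := by
        rw [← nsmul_eq_mul]
        exact (Finset.abs_sum_le_sum_abs _ _).trans (Finset.sum_le_card_nsmul _ _ _ fun x _ => hr x)
      gcongr
      exact hf σ
    _ = B := by ring

lemma abs_step_pow_le (hp : IsProb p) (h0 : 0 ≤ h) (h1 : h * Λ.card ≤ 1) {f : Config d → ℝ}
    {B : ℝ} (hf : ∀ σ, |f σ| ≤ B) (n : ℕ) (σ : Config d) : |(step p Λ h ^ n) f σ| ≤ B := by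
  induction n generalizing σ with
  | zero => simpa using hf σ
  | succ n ih =>
    rw [pow_succ', Module.End.mul_apply]
    exact abs_step_le hp h0 h1 ih σ

/-! ### Finite speed of propagation -/

/-- The ball of radius `r` around `x` in the `ℓ^∞`-distance, as a finite set. -/
noncomputable def ballFinset (r : ℕ) (x : Site d) : Finset (Site d) :=
  Finset.Icc (fun i => x i - r) (fun i => x i + r)

lemma mem_ballFinset {r : ℕ} {x y : Site d} : y ∈ ballFinset r x ↔ y ∈ ball r x := by
  simp only [ballFinset, Finset.mem_Icc, Pi.le_def, ball, Set.mem_ofPred_eq, abs_le]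
  constructor
  · rintro ⟨h1, h2⟩ i; have := h1 i; have := h2 i; constructor <;> linarith
  · intro h; constructor <;> intro i <;> have := h i <;> linarith [this.1, this.2]

lemma mem_ball_comm {r : ℕ} {x y : Site d} : y ∈ ball r x ↔ x ∈ ball r y := by
  simp only [ball, Set.mem_ofPred_eq, abs_sub_comm]

lemma card_ballFinset (r : ℕ) (x : Site d) : (ballFinset r x).card = (2 * r + 1) ^ d := by
  rw [ballFinset, Pi.card_Icc]
  have : ∀ i : Fin d, (Finset.Icc (x i - (r : ℤ)) (x i + r)).card = 2 * r + 1 := by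
    intro i; rw [Int.card_Icc]; omega
  simp [this]

lemma disc_update_of_ne {x z : Site d} (hxz : z ≠ x) (σ τ : Config d) (a b : ℤˣ) :
    disc z (Function.update σ x a) (Function.update τ x b) = disc z σ τ := by
  simp [disc, hxz]

lemma pairResample_disc_of_ne {x z : Site d} (hxz : z ≠ x) (σ τ : Config d) :
    pairResample p x (disc z) σ τ = disc z σ τ := by
  simp only [pairResample_apply, disc_update_of_ne hxz]
  have := min_add_max (p x σ) (p x τ)
  have h2 : max (p x σ) (p x τ) = p x σ + p x τ - min (p x σ) (p x τ) := by linarith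
  rw [h2]; ring

lemma pairResample_disc_self {r : ℕ} (hp : IsProb p) (hr : ∀ x, DependsOn (p x) (ball r x))
    (x : Site d) (σ τ : Config d) :
    pairResample p x (disc x) σ τ ≤ ∑ u ∈ ballFinset r x, disc u σ τ := by
  have e : (1 : ℤˣ) ≠ -1 := by decide
  have e' : (-1 : ℤˣ) ≠ 1 := by decide
  have heq : pairResample p x (disc x) σ τ =
      p x σ + p x τ - 2 * min (p x σ) (p x τ) := by
    simp only [pairResample_apply, disc, Function.update_self, if_true, if_neg e, if_neg e']
    ring
  rw [heq]
  by_cases hcase : ∀ u ∈ ball r x, σ u = τ u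
  · rw [hr x hcase, min_self]
    have : p x τ + p x τ - 2 * p x τ = 0 := by ring
    rw [this]
    exact Finset.sum_nonneg fun u _ => disc_nonneg u σ τ
  · push Not at hcase
    obtain ⟨u, hu, hne⟩ := hcase
    calc p x σ + p x τ - 2 * min (p x σ) (p x τ) ≤ 1 := by
          rcases min_cases (p x σ) (p x τ) with h | h <;> rw [h.1] <;>
            linarith [(hp x σ).1, (hp x σ).2, (hp x τ).1, (hp x τ).2]
      _ = disc u σ τ := by simp [disc, hne]
      _ ≤ _ := Finset.single_le_sum (f := fun u => disc u σ τ) (fun u _ => disc_nonneg u σ τ)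
          (mem_ballFinset.2 hu)

lemma pairStep_disc {r : ℕ} (hp : IsProb p) (hr : ∀ x, DependsOn (p x) (ball r x)) (h0 : 0 ≤ h)
    (z : Site d) (σ τ : Config d) :
    pairStep p Λ h (disc z) σ τ ≤
      disc z σ τ + h * if z ∈ Λ then ∑ u ∈ ballFinset r z, disc u σ τ else 0 := by
  rw [pairStep_apply]
  gcongr
  by_cases hz : z ∈ Λ
  · rw [if_pos hz, Finset.sum_eq_single_of_mem z hz
      (fun x _ hx => by rw [pairResample_disc_of_ne hx.symm, sub_self])]
    linarith [pairResample_disc_self hp hr z σ τ, disc_nonneg z σ τ]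
  · rw [if_neg hz]
    exact le_of_eq (Finset.sum_eq_zero fun x hx => by
      rw [pairResample_disc_of_ne (by rintro rfl; exact hz hx), sub_self])

/-- A weight `w` that changes by a factor at most `ρ` over the range of the rates is almost
superharmonic for the coupled dynamics: the weighted number of discrepancies grows by a factor at
most `1 + h M`, `M = (2 r + 1)^d ρ`, in one step. -/
lemma pairStep_weight {r : ℕ} (hp : IsProb p) (hr : ∀ x, DependsOn (p x) (ball r x))
    (h0 : 0 ≤ h) {w : Site d → ℝ} (hw : ∀ z, 0 ≤ w z) {ρ : ℝ} (hρ : 0 ≤ ρ)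
    (hwr : ∀ z, ∀ u ∈ ball r z, w z ≤ ρ * w u) {V : Finset (Site d)}
    (hV : ∀ z ∈ Λ, ballFinset r z ⊆ V) :
    pairStep p Λ h (∑ z ∈ V, w z • disc z) ≤
      (1 + h * ((2 * r + 1) ^ d * ρ)) • ∑ z ∈ V, w z • disc z := by
  intro σ τ
  simp only [map_sum, map_smul, Finset.sum_apply, Pi.smul_apply, smul_eq_mul]
  have key : ∑ z ∈ V, w z * (if z ∈ Λ then ∑ u ∈ ballFinset r z, disc u σ τ else 0) ≤
      ((2 * r + 1) ^ d * ρ) * ∑ u ∈ V, w u * disc u σ τ := by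
    calc _ ≤ ∑ z ∈ V, ∑ u ∈ V, if z ∈ ballFinset r u then ρ * (w u * disc u σ τ) else 0 := by
          refine Finset.sum_le_sum fun z _ => ?_
          have hnn : ∀ u, 0 ≤ ρ * (w u * disc u σ τ) := fun u =>
            mul_nonneg hρ (mul_nonneg (hw u) (disc_nonneg _ _ _))
          split_ifs with hz
          · rw [← Finset.sum_filter, Finset.mul_sum]
            refine (Finset.sum_le_sum (g := fun u => ρ * (w u * disc u σ τ))
              fun u hu => ?_).trans (Finset.sum_le_sum_of_subset_of_nonneg ?_ fun u _ _ => hnn u)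
            · rw [← mul_assoc]
              exact mul_le_mul_of_nonneg_right (hwr z u (mem_ballFinset.1 hu)) (disc_nonneg _ _ _)
            · intro u hu
              exact Finset.mem_filter.2 ⟨hV z hz hu,
                mem_ballFinset.2 (mem_ball_comm.1 (mem_ballFinset.1 hu))⟩
          · rw [mul_zero]
            exact Finset.sum_nonneg fun u _ => by split_ifs <;> first | exact hnn u | exact le_rfl
      _ = ∑ u ∈ V, ∑ z ∈ V, if z ∈ ballFinset r u then ρ * (w u * disc u σ τ) else 0 :=
          Finset.sum_comm
      _ ≤ ∑ u ∈ V, ((2 * r + 1) ^ d * (ρ * (w u * disc u σ τ)) : ℝ) := by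
          refine Finset.sum_le_sum fun u _ => ?_
          rw [← Finset.sum_filter, Finset.sum_const, nsmul_eq_mul]
          have hnn : 0 ≤ ρ * (w u * disc u σ τ) :=
            mul_nonneg hρ (mul_nonneg (hw u) (disc_nonneg _ _ _))
          refine mul_le_mul_of_nonneg_right ?_ hnn
          have : (V.filter (· ∈ ballFinset r u)).card ≤ (ballFinset r u).card :=
            Finset.card_le_card fun z hz => (Finset.mem_filter.1 hz).2
          rw [card_ballFinset] at this
          exact_mod_cast this
      _ = _ := by rw [Finset.mul_sum]; exact Finset.sum_congr rfl fun u _ => by ring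
  calc _ ≤ ∑ z ∈ V, w z * (disc z σ τ +
        h * if z ∈ Λ then ∑ u ∈ ballFinset r z, disc u σ τ else 0) :=
        Finset.sum_le_sum fun z _ =>
          mul_le_mul_of_nonneg_left (pairStep_disc hp hr h0 z σ τ) (hw z)
    _ = ∑ z ∈ V, w z * disc z σ τ +
        h * ∑ z ∈ V, w z * (if z ∈ Λ then ∑ u ∈ ballFinset r z, disc u σ τ else 0) := by
        rw [Finset.mul_sum, ← Finset.sum_add_distrib]
        exact Finset.sum_congr rfl fun z _ => by ring
    _ ≤ _ := by nlinarith [mul_le_mul_of_nonneg_left key h0]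

/-- The `ℓ^1`-distance on `ℤ^d`. -/
noncomputable def dist₁ (x y : Site d) : ℝ := ∑ i, |(y i : ℝ) - x i|

lemma dist₁_self (x : Site d) : dist₁ x x = 0 := by simp [dist₁]

lemma dist₁_nonneg (x y : Site d) : 0 ≤ dist₁ x y := Finset.sum_nonneg fun _ _ => abs_nonneg _

lemma dist₁_le_of_mem_ball {r : ℕ} {x z u : Site d} (hu : u ∈ ball r z) :
    dist₁ x u ≤ dist₁ x z + d * r := by
  have : ∀ i, |(u i : ℝ) - x i| ≤ |(z i : ℝ) - x i| + r := by
    intro i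
    have h1 : |(u i : ℝ) - z i| ≤ r := by exact_mod_cast hu i
    calc |(u i : ℝ) - x i| = |((z i : ℝ) - x i) + ((u i : ℝ) - z i)| := by congr 1; ring
      _ ≤ |(z i : ℝ) - x i| + |(u i : ℝ) - z i| := abs_add_le _ _
      _ ≤ _ := by linarith
  calc dist₁ x u ≤ ∑ i : Fin d, (|(z i : ℝ) - x i| + r) := Finset.sum_le_sum fun i _ => this i
    _ = _ := by simp [dist₁, Finset.sum_add_distrib]

lemma lt_dist₁_of_notMem_ball {R : ℕ} {x y : Site d} (hy : y ∉ ball R x) : (R : ℝ) < dist₁ x y := by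
  simp only [ball, Set.mem_ofPred_eq, not_forall, not_le] at hy
  obtain ⟨i, hi⟩ := hy
  calc (R : ℝ) < |(y i : ℝ) - x i| := by exact_mod_cast hi
    _ ≤ _ := Finset.single_le_sum (f := fun i => |(y i : ℝ) - x i|) (fun _ _ => abs_nonneg _)
      (Finset.mem_univ i)

/-- `e^{-|y|_1}` is summable over `ℤ^d`. -/
lemma exists_sum_exp_dist₁_le (d : ℕ) : ∃ S : ℝ, 0 < S ∧ ∀ (x : Site d) (V : Finset (Site d)),
    ∑ y ∈ V, Real.exp (-dist₁ x y) ≤ S := by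
  have hs : Summable fun k : ℤ => Real.exp (-|(k : ℝ)|) := by
    refine Summable.of_nat_of_neg ?_ ?_ <;>
    · refine Real.summable_exp_neg_nat.congr fun n => ?_
      simp
  set s := ∑' k : ℤ, Real.exp (-|(k : ℝ)|)
  have hpos : 0 < s := hs.tsum_pos (fun _ => (Real.exp_pos _).le) 0 (Real.exp_pos _)
  refine ⟨s ^ d, pow_pos hpos d, fun x V => ?_⟩
  have hone : ∀ (a : ℤ) (F : Finset ℤ), ∑ k ∈ F, Real.exp (-|(k : ℝ) - a|) ≤ s := by
    intro a F
    have h1 : Summable fun k : ℤ => Real.exp (-|(k : ℝ) - a|) := by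
      have := (Equiv.subRight a).summable_iff.2 hs
      refine this.congr fun k => ?_
      simp
    have h2 : ∑' k : ℤ, Real.exp (-|(k : ℝ) - a|) = s := by
      refine Eq.trans (tsum_congr fun k => ?_)
        ((Equiv.subRight a).tsum_eq (fun k : ℤ => Real.exp (-|(k : ℝ)|)))
      simp
    rw [← h2]
    exact h1.sum_le_tsum F fun _ _ => (Real.exp_pos _).le
  calc ∑ y ∈ V, Real.exp (-dist₁ x y)
      ≤ ∑ y ∈ Fintype.piFinset fun i => V.image (fun y : Site d => y i), Real.exp (-dist₁ x y) := by
        refine Finset.sum_le_sum_of_subset_of_nonneg (fun y hy => ?_)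
          fun _ _ _ => (Real.exp_pos _).le
        exact Fintype.mem_piFinset.2 fun i => Finset.mem_image_of_mem _ hy
    _ = ∏ i, ∑ k ∈ V.image (fun y : Site d => y i), Real.exp (-|(k : ℝ) - x i|) := by
        rw [Finset.prod_univ_sum]
        refine Finset.sum_congr rfl fun y _ => ?_
        rw [dist₁, ← Finset.sum_neg_distrib, Real.exp_sum]
    _ ≤ ∏ _i : Fin d, s :=
        Finset.prod_le_prod (fun _ _ => Finset.sum_nonneg fun _ _ => (Real.exp_pos _).le)
          fun i _ => hone _ _
    _ = s ^ d := by simp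

/-- The exponential rate at which discrepancies spread. -/
noncomputable def speed (d r : ℕ) : ℝ := (2 * r + 1) ^ d * Real.exp (2 * (d * r))

lemma speed_nonneg (d r : ℕ) : 0 ≤ speed d r := by unfold speed; positivity

/-- A discrepancy at a single site `y` reaches `x` after `n` steps with a probability that is
exponentially small in the distance. -/
lemma pairStep_pow_disc_le {r : ℕ} (hp : IsProb p) (hr : ∀ x, DependsOn (p x) (ball r x))
    (h0 : 0 ≤ h) (h1 : h * Λ.card ≤ 1) (n : ℕ) (x y : Site d) {σ τ : Config d}
    (hστ : ∀ z, z ≠ y → σ z = τ z) :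
    (pairStep p Λ h ^ n) (disc x) σ τ ≤
      Real.exp (n * h * speed d r) * Real.exp (-2 * dist₁ x y) := by
  classical
  set w : Site d → ℝ := fun z => Real.exp (-2 * dist₁ x z)
  have hw : ∀ z, 0 ≤ w z := fun z => (Real.exp_pos _).le
  set V : Finset (Site d) := insert x (Λ.biUnion (ballFinset r))
  set Φ : Config d → Config d → ℝ := ∑ z ∈ V, w z • disc z with hΦ
  have hΦ0 : ∀ σ τ, 0 ≤ Φ σ τ := fun σ τ => by
    simp only [hΦ, Finset.sum_apply, Pi.smul_apply, smul_eq_mul]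
    exact Finset.sum_nonneg fun z _ => mul_nonneg (hw z) (disc_nonneg _ _ _)
  have hstep : pairStep p Λ h Φ ≤ (1 + h * speed d r) • Φ := by
    refine pairStep_weight hp hr h0 hw (Real.exp_pos _).le (fun z u hu => ?_) fun z hz => ?_
    · rw [← Real.exp_add, Real.exp_le_exp]
      linarith [dist₁_le_of_mem_ball (x := x) hu]
    · exact (Finset.subset_biUnion_of_mem _ hz).trans (Finset.subset_insert _ _)
  have hk : 0 ≤ 1 + h * speed d r := by linarith [mul_nonneg h0 (speed_nonneg d r)]
  have hbase : disc x ≤ Φ := by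
    intro σ τ
    simp only [hΦ, Finset.sum_apply, Pi.smul_apply, smul_eq_mul]
    calc disc x σ τ = w x * disc x σ τ := by simp [w, dist₁_self]
      _ ≤ _ := Finset.single_le_sum (f := fun z => w z * disc z σ τ)
        (fun z _ => mul_nonneg (hw z) (disc_nonneg _ _ _)) (Finset.mem_insert_self _ _)
  have hpow : (pairStep p Λ h ^ n) Φ ≤ (1 + h * speed d r) ^ n • Φ := by
    induction n with
    | zero => simp
    | succ n ih =>
      rw [pow_succ', Module.End.mul_apply]
      calc _ ≤ pairStep p Λ h ((1 + h * speed d r) ^ n • Φ) := pairStep_mono hp h0 h1 ih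
        _ = (1 + h * speed d r) ^ n • pairStep p Λ h Φ := map_smul _ _ _
        _ ≤ (1 + h * speed d r) ^ n • ((1 + h * speed d r) • Φ) :=
          smul_le_smul_of_nonneg_left hstep (pow_nonneg hk n)
        _ = _ := by rw [smul_smul, pow_succ]
  have hlast : Φ σ τ ≤ w y := by
    simp only [hΦ, Finset.sum_apply, Pi.smul_apply, smul_eq_mul]
    calc ∑ z ∈ V, w z * disc z σ τ ≤ ∑ z ∈ V, if z = y then w y else 0 := by
          refine Finset.sum_le_sum fun z _ => ?_
          split_ifs with hz
          · subst hz
            refine mul_le_of_le_one_right (hw z) ?_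
            unfold disc; split_ifs <;> norm_num
          · simp [disc, hστ z hz]
      _ ≤ w y := by
          rw [Finset.sum_ite_eq']; split_ifs <;> [exact le_rfl; exact hw y]
  calc _ ≤ (pairStep p Λ h ^ n) Φ σ τ := pairStep_pow_mono hp h0 h1 hbase n σ τ
    _ ≤ (1 + h * speed d r) ^ n * Φ σ τ := hpow σ τ
    _ ≤ Real.exp (n * h * speed d r) * w y := by
      refine mul_le_mul ?_ hlast (hΦ0 _ _) (Real.exp_pos _).le
      rw [mul_assoc, Real.exp_nat_mul]
      refine pow_le_pow_left₀ hk ?_ n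
      linarith [Real.add_one_le_exp (h * speed d r)]

/-! ### Comparison with attractive dynamics -/

lemma update_sup_update (σ τ : Config d) (z : Site d) (a b : ℤˣ) :
    Function.update σ z a ⊔ Function.update τ z b = Function.update (σ ⊔ τ) z (a ⊔ b) := by
  ext1 y; by_cases hy : y = z
  · subst hy; simp
  · simp [hy]

lemma update_inf_update (σ τ : Config d) (z : Site d) (a b : ℤˣ) :
    Function.update σ z a ⊓ Function.update τ z b = Function.update (σ ⊓ τ) z (a ⊓ b) := by
  ext1 y; by_cases hy : y = z
  · subst hy; simp
  · simp [hy]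

/-- The increment of `u` at `z`. -/
noncomputable def incr (z : Site d) (u : Config d → ℝ) (σ : Config d) : ℝ :=
  u (Function.update σ z 1) - u (Function.update σ z (-1))

lemma update_neg_one_le (σ : Config d) (z : Site d) :
    Function.update σ z (-1) ≤ Function.update σ z 1 :=
  update_le_update_iff.2 ⟨by decide, fun _ _ => le_rfl⟩

lemma pairResample_sup_inf {p₀ p₁ : Site d → Config d → ℝ} {ε : ℝ}
    (hmono : ∀ x, Monotone (p₀ x)) (hε : ∀ x σ, |p₀ x σ - p₁ x σ| ≤ ε) (z : Site d)
    {u : Config d → ℝ} (hu : Monotone u) (σ τ : Config d) :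
    pairResample p₁ z (fun σ τ => u (σ ⊔ τ) - u (σ ⊓ τ)) σ τ ≤
      resample p₀ z u (σ ⊔ τ) - resample p₀ z u (σ ⊓ τ) +
        ε * (incr z u (σ ⊔ τ) + incr z u (σ ⊓ τ)) := by
  simp only [pairResample_apply, resample_apply, update_sup_update, update_inf_update, incr]
  have e1 : (1 : ℤˣ) ⊔ 1 = 1 := by decide
  have e2 : (1 : ℤˣ) ⊔ -1 = 1 := by decide
  have e3 : (-1 : ℤˣ) ⊔ 1 = 1 := by decide
  have e4 : (-1 : ℤˣ) ⊔ -1 = -1 := by decide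
  have e5 : (1 : ℤˣ) ⊓ 1 = 1 := by decide
  have e6 : (1 : ℤˣ) ⊓ -1 = -1 := by decide
  have e7 : (-1 : ℤˣ) ⊓ 1 = -1 := by decide
  have e8 : (-1 : ℤˣ) ⊓ -1 = -1 := by decide
  rw [e1, e2, e3, e4, e5, e6, e7, e8]
  have m1 := hu (update_neg_one_le (σ ⊔ τ) z)
  have m2 := hu (update_neg_one_le (σ ⊓ τ) z)
  set a := u (Function.update (σ ⊔ τ) z 1)
  set b := u (Function.update (σ ⊔ τ) z (-1))
  set a' := u (Function.update (σ ⊓ τ) z 1)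
  set b' := u (Function.update (σ ⊓ τ) z (-1))
  have hmin : p₀ z (σ ⊓ τ) - ε ≤ min (p₁ z σ) (p₁ z τ) :=
    le_min (by linarith [hmono z (inf_le_left : σ ⊓ τ ≤ σ), (abs_le.1 (hε z σ)).2])
      (by linarith [hmono z (inf_le_right : σ ⊓ τ ≤ τ), (abs_le.1 (hε z τ)).2])
  have hmax : max (p₁ z σ) (p₁ z τ) ≤ p₀ z (σ ⊔ τ) + ε :=
    max_le (by linarith [hmono z (le_sup_left : σ ≤ σ ⊔ τ), (abs_le.1 (hε z σ)).1])
      (by linarith [hmono z (le_sup_right : τ ≤ σ ⊔ τ), (abs_le.1 (hε z τ)).1])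
  have hsum := min_add_max (p₁ z σ) (p₁ z τ)
  set q := min (p₁ z σ) (p₁ z τ)
  set m := max (p₁ z σ) (p₁ z τ)
  have hτ : p₁ z τ = q + m - p₁ z σ := by linarith
  rw [hτ]
  -- the left side equals `m a + (1 - m) b - (q a' + (1 - q) b')`
  nlinarith [mul_le_mul_of_nonneg_right hmax (sub_nonneg.2 m1),
    mul_le_mul_of_nonneg_right hmin (sub_nonneg.2 m2)]

lemma pairStep_sup_inf {p₀ p₁ : Site d → Config d → ℝ} {ε B e : ℝ} (hp₁ : IsProb p₁)
    (hmono : ∀ x, Monotone (p₀ x)) (hε : ∀ x σ, |p₀ x σ - p₁ x σ| ≤ ε) (hε0 : 0 ≤ ε) (h0 : 0 ≤ h)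
    (h1 : h * Λ.card ≤ 1) {u : Config d → ℝ} (hu : Monotone u)
    (hB : ∀ σ, ∑ z ∈ Λ, incr z u σ ≤ B) {Ψ : Config d → Config d → ℝ}
    (hΨ : ∀ σ τ, Ψ σ τ ≤ u (σ ⊔ τ) - u (σ ⊓ τ) + e) (σ τ : Config d) :
    pairStep p₁ Λ h Ψ σ τ ≤
      step p₀ Λ h u (σ ⊔ τ) - step p₀ Λ h u (σ ⊓ τ) + (e + 2 * h * ε * B) := by
  set Φ : Config d → Config d → ℝ := fun σ τ => u (σ ⊔ τ) - u (σ ⊓ τ)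
  have hconst : pairStep p₁ Λ h (fun _ _ => e) = fun _ _ => e := by
    ext σ τ
    rw [pairStep_apply, Finset.sum_eq_zero, mul_zero, add_zero]
    intro x _
    rw [pairResample_apply]
    linarith [congrArg (e * ·) (min_add_max (p₁ x σ) (p₁ x τ))]
  have hadd : pairStep p₁ Λ h Ψ σ τ ≤ pairStep p₁ Λ h Φ σ τ + e := by
    have := pairStep_mono hp₁ h0 h1 (Ψ := Ψ) (Φ := Φ + fun _ _ => e) hΨ σ τ
    rw [map_add, hconst] at this
    exact this
  refine hadd.trans ?_
  have hsum : ∑ z ∈ Λ, pairResample p₁ z Φ σ τ ≤ ∑ z ∈ Λ, resample p₀ z u (σ ⊔ τ) -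
      ∑ z ∈ Λ, resample p₀ z u (σ ⊓ τ) + ε * (2 * B) := by
    calc _ ≤ ∑ z ∈ Λ, (resample p₀ z u (σ ⊔ τ) - resample p₀ z u (σ ⊓ τ) +
          ε * (incr z u (σ ⊔ τ) + incr z u (σ ⊓ τ))) :=
          Finset.sum_le_sum fun z _ => pairResample_sup_inf hmono hε z hu σ τ
      _ = ∑ z ∈ Λ, resample p₀ z u (σ ⊔ τ) - ∑ z ∈ Λ, resample p₀ z u (σ ⊓ τ) +
          ε * (∑ z ∈ Λ, incr z u (σ ⊔ τ) + ∑ z ∈ Λ, incr z u (σ ⊓ τ)) := by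
          rw [Finset.sum_add_distrib, Finset.sum_sub_distrib, ← Finset.mul_sum,
            Finset.sum_add_distrib]
      _ ≤ _ := by
          have := hB (σ ⊔ τ)
          have := hB (σ ⊓ τ)
          gcongr
          linarith
  rw [pairStep_apply', step_apply', step_apply']
  have := mul_le_mul_of_nonneg_left hsum h0
  simp only [Φ] at this ⊢
  linarith

lemma monotone_plus (x : Site d) : Monotone (plus x) := by
  intro σ τ hle
  have h1 : σ x ≤ τ x := hle x
  unfold plus
  rcases Int.units_eq_one_or (σ x) with h | h <;> rcases Int.units_eq_one_or (τ x) with h' | h' <;>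
    simp only [h, h'] at h1 ⊢ <;> first | exact absurd h1 (by decide) | (split_ifs <;> norm_num)

lemma disc_eq_plus (x : Site d) (σ τ : Config d) :
    disc x σ τ = plus x (σ ⊔ τ) - plus x (σ ⊓ τ) := by
  have e : (1 : ℤˣ) ≠ -1 := by decide
  have e' : (-1 : ℤˣ) ≠ 1 := by decide
  have e2 : (1 : ℤˣ) ⊔ -1 = 1 := by decide
  have e3 : (-1 : ℤˣ) ⊔ 1 = 1 := by decide
  have e6 : (1 : ℤˣ) ⊓ -1 = -1 := by decide
  have e7 : (-1 : ℤˣ) ⊓ 1 = -1 := by decide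
  simp only [disc, plus, Pi.sup_apply, Pi.inf_apply]
  rcases Int.units_eq_one_or (σ x) with h | h <;> rcases Int.units_eq_one_or (τ x) with h' | h' <;>
    simp [h, h', e, e', e2, e3, e6, e7]

lemma abs_plus_sub_le_disc (x : Site d) (σ τ : Config d) : |plus x σ - plus x τ| ≤ disc x σ τ := by
  unfold disc plus
  by_cases h : σ x = τ x
  · simp [h]
  · rw [if_neg h]
    split_ifs <;> norm_num

/-- The probability that the coupled dynamics with parameters `p₁` has a discrepancy at `x` is
bounded in terms of nearby attractive dynamics started from the maximum and the minimum of the two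
configurations. -/
lemma pairStep_pow_disc_le_attractive {r : ℕ} {p₀ p₁ : Site d → Config d → ℝ} {ε S : ℝ}
    (hp₀ : IsProb p₀) (hr : ∀ x, DependsOn (p₀ x) (ball r x)) (hp₁ : IsProb p₁)
    (hmono : ∀ x, Monotone (p₀ x)) (hε : ∀ x σ, |p₀ x σ - p₁ x σ| ≤ ε) (hε0 : 0 ≤ ε) (h0 : 0 ≤ h)
    (h1 : h * Λ.card ≤ 1)
    (hS : ∀ (x : Site d) (V : Finset (Site d)), ∑ y ∈ V, Real.exp (-dist₁ x y) ≤ S)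
    (n : ℕ) (x : Site d) (σ τ : Config d) :
    (pairStep p₁ Λ h ^ n) (disc x) σ τ ≤
      (step p₀ Λ h ^ n) (plus x) (σ ⊔ τ) - (step p₀ Λ h ^ n) (plus x) (σ ⊓ τ) +
        2 * (n * h) * ε * (Real.exp (n * h * speed d r) * S) := by
  suffices H : ∀ k ≤ n, ∀ σ τ, (pairStep p₁ Λ h ^ k) (disc x) σ τ ≤
      (step p₀ Λ h ^ k) (plus x) (σ ⊔ τ) - (step p₀ Λ h ^ k) (plus x) (σ ⊓ τ) +
        k * (2 * h * ε * (Real.exp (n * h * speed d r) * S)) by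
    refine (H n le_rfl σ τ).trans (le_of_eq ?_)
    ring
  intro k
  induction k with
  | zero => intro _ σ τ; simp [disc_eq_plus]
  | succ k ih =>
    intro hk σ τ
    rw [pow_succ', pow_succ', Module.End.mul_apply, Module.End.mul_apply]
    refine (pairStep_sup_inf (B := Real.exp (n * h * speed d r) * S) hp₁ hmono hε hε0 h0 h1
      (step_pow_mono_config hp₀ hmono h0 h1 (monotone_plus x) k) (fun ξ => ?_)
      (ih (by omega)) σ τ).trans (le_of_eq ?_)
    · calc ∑ z ∈ Λ, incr z ((step p₀ Λ h ^ k) (plus x)) ξ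
          ≤ ∑ z ∈ Λ, Real.exp (n * h * speed d r) * Real.exp (-dist₁ x z) := by
            refine Finset.sum_le_sum fun z _ => ?_
            refine (le_abs_self _).trans ((abs_step_pow_sub_le hp₀ h0 h1
              (abs_plus_sub_le_disc x) k _ _).trans ((pairStep_pow_disc_le hp₀ hr h0 h1 k x z
              fun y hy => by simp [hy]).trans ?_))
            have : (k : ℝ) ≤ n := by exact_mod_cast (by omega : k ≤ n)
            have := speed_nonneg d r
            have := dist₁_nonneg x z
            gcongr
            linarith
        _ ≤ _ := by
            rw [← Finset.mul_sum]
            exact mul_le_mul_of_nonneg_left (hS x Λ) (Real.exp_pos _).le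
    · push_cast; ring

end dynamics

/-! ### Oscillations of functions on the configuration space -/

/-- The oscillation of `f` at the site `x`. -/
noncomputable def osc (f : Config d → ℝ) (x : Site d) : ℝ := ⨆ σ, |f (flip x σ) - f σ|

lemma osc_nonneg (f : Config d → ℝ) (x : Site d) : 0 ≤ osc f x :=
  Real.iSup_nonneg fun _ => abs_nonneg _

lemma osc_le {f : Config d → ℝ} {x : Site d} {b : ℝ} (hb : ∀ σ, |f (flip x σ) - f σ| ≤ b) :
    osc f x ≤ b := ciSup_le hb

lemma exists_abs_le {f : Config d → ℝ} (hf : Continuous f) : ∃ B, ∀ σ, |f σ| ≤ B := by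
  obtain ⟨B, hB⟩ := isCompact_univ.exists_bound_of_continuousOn hf.continuousOn
  exact ⟨B, fun σ => hB σ (Set.mem_univ _)⟩

lemma le_osc {f : Config d → ℝ} (hf : Continuous f) (x : Site d) (σ : Config d) :
    |f (flip x σ) - f σ| ≤ osc f x := by
  obtain ⟨B, hB⟩ := exists_abs_le hf
  refine le_ciSup (f := fun σ => |f (flip x σ) - f σ|) ⟨B + B, ?_⟩ σ
  rintro _ ⟨τ, rfl⟩
  exact (abs_sub _ _).trans (add_le_add (hB _) (hB _))

lemma flip_of_ne {x y : Site d} (hy : y ≠ x) (σ : Config d) : flip x σ y = σ y := by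
  simp [flip, hy]

/-- Passing from `τ` to `σ` on the sites in `V`, one site at a time. -/
lemma abs_piecewise_sub_le {f : Config d → ℝ} (hf : Continuous f) (V : Finset (Site d))
    (σ τ : Config d) : |f (V.piecewise σ τ) - f τ| ≤ ∑ x ∈ V, osc f x * disc x σ τ := by
  induction V using Finset.induction_on with
  | empty => simp
  | insert a V ha ih =>
    rw [Finset.sum_insert ha, Finset.piecewise_insert]
    have hval : V.piecewise σ τ a = τ a := Finset.piecewise_eq_of_notMem _ _ _ ha
    by_cases hc : σ a = τ a
    · rw [hc, ← hval, Function.update_eq_self]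
      simpa [disc, hc] using ih
    · have hneg : σ a = -V.piecewise σ τ a := by
        rw [hval]
        rcases Int.units_eq_one_or (σ a) with h | h <;>
          rcases Int.units_eq_one_or (τ a) with h' | h' <;> simp_all
      have := le_osc hf a (V.piecewise σ τ)
      rw [flip, ← hneg] at this
      have hd : disc a σ τ = 1 := by simp [disc, hc]
      rw [hd, mul_one]
      calc _ = |(f (Function.update (V.piecewise σ τ) a (σ a)) - f (V.piecewise σ τ)) +
            (f (V.piecewise σ τ) - f τ)| := by congr 1; ring
        _ ≤ _ := (abs_add_le _ _).trans (add_le_add this ih)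

lemma continuous_of_dependsOn {f : Config d → ℝ} {X : Finset (Site d)}
    (hf : DependsOn f (X : Set (Site d))) : Continuous f := by
  have h1 : f = (fun ξ : X → ℤˣ => f (fun y => if hy : y ∈ X then ξ ⟨y, hy⟩ else 1)) ∘
      (fun σ y => σ y) := by
    ext σ
    exact hf fun y hy => by simp [Finset.mem_coe.1 hy]
  rw [h1]
  exact continuous_of_discreteTopology.comp (continuous_pi fun y => continuous_apply _)

lemma IsCylinder.continuous {f : Config d → ℝ} (hf : IsCylinder f) : Continuous f :=
  continuous_of_dependsOn hf.choose_spec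

lemma abs_sub_le_of_dependsOn {f : Config d → ℝ} {X : Finset (Site d)}
    (hf : DependsOn f (X : Set (Site d))) (σ τ : Config d) :
    |f σ - f τ| ≤ (∑ x ∈ X, osc f x • disc x) σ τ := by
  have h1 := abs_piecewise_sub_le (continuous_of_dependsOn hf) X σ τ
  have h2 : f (X.piecewise σ τ) = f σ :=
    hf fun y hy => Finset.piecewise_eq_of_mem _ _ _ (Finset.mem_coe.1 hy)
  rw [h2] at h1
  simpa only [Finset.sum_apply, Pi.smul_apply, smul_eq_mul] using h1

/-! ### Expectations under the Feller process -/

/-- The expectation `𝔼_σ (f_t)`. -/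
noncomputable def expect (P : ℝ≥0 → Kernel (Config d) (Config d)) (t : ℝ≥0) (f : Config d → ℝ)
    (σ : Config d) : ℝ := ∫ η, f η ∂(P t σ)

section expect

variable {c : Site d → Config d → ℝ} {P : ℝ≥0 → Kernel (Config d) (Config d)}

lemma integrable_of_continuous {f : Config d → ℝ} (hf : Continuous f) (μ : Measure (Config d))
    [IsFiniteMeasure μ] : Integrable f μ := by
  obtain ⟨B, hB⟩ := exists_abs_le hf
  exact Integrable.of_bound hf.aestronglyMeasurable B (Eventually.of_forall hB)

lemma abs_integral_sub_le {f g : Config d → ℝ} (hf : Continuous f) (hg : Continuous g)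
    {μ : Measure (Config d)} [IsProbabilityMeasure μ] {b : ℝ} (hb : ∀ σ, |f σ - g σ| ≤ b) :
    |∫ σ, f σ ∂μ - ∫ σ, g σ ∂μ| ≤ b := by
  rw [← integral_sub (integrable_of_continuous hf μ) (integrable_of_continuous hg μ)]
  have := norm_integral_le_of_norm_le_const (μ := μ) (f := fun σ => f σ - g σ)
    (Eventually.of_forall hb)
  simpa using this

lemma IsSpinFlipProcess.continuous_expect (hP : IsSpinFlipProcess c P) (t : ℝ≥0)
    {f : Config d → ℝ} (hf : Continuous f) : Continuous (expect P t f) :=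
  hP.feller t ⟨f, hf⟩

lemma IsSpinFlipProcess.abs_expect_sub_le (hP : IsSpinFlipProcess c P) (t : ℝ≥0)
    {f g : Config d → ℝ} (hf : Continuous f) (hg : Continuous g) {b : ℝ}
    (hb : ∀ σ, |f σ - g σ| ≤ b) (σ : Config d) : |expect P t f σ - expect P t g σ| ≤ b := by
  have := hP.markov t
  exact abs_integral_sub_le hf hg hb

lemma IsSpinFlipProcess.expect_zero (hP : IsSpinFlipProcess c P) {f : Config d → ℝ}
    (hf : Continuous f) (σ : Config d) : expect P 0 f σ = f σ := by
  rw [expect, hP.zero, Kernel.id_apply, integral_dirac' _ _ hf.stronglyMeasurable]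

lemma IsSpinFlipProcess.expect_add (hP : IsSpinFlipProcess c P) (s t : ℝ≥0)
    {f : Config d → ℝ} (hf : Continuous f) (σ : Config d) :
    expect P (s + t) f σ = expect P s (expect P t f) σ := by
  have := hP.markov (s + t)
  have hi : Integrable f ((P t ∘ₖ P s) σ) := by
    rw [← hP.add]; exact integrable_of_continuous hf _
  rw [expect, hP.add, Kernel.integral_comp hi]
  rfl

lemma IsSpinFlipProcess.expect_sum (hP : IsSpinFlipProcess c P) (t : ℝ≥0) {ι : Type*}
    (I : Finset ι) (a : ι → ℝ) {e : ι → Config d → ℝ} (he : ∀ i, Continuous (e i))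
    (σ : Config d) :
    expect P t (fun τ => ∑ i ∈ I, a i * e i τ) σ = ∑ i ∈ I, a i * expect P t (e i) σ := by
  have := hP.markov t
  rw [expect, integral_finsetSum]
  · exact Finset.sum_congr rfl fun i _ => integral_const_mul _ _
  · exact fun i _ => (integrable_of_continuous (he i) _).const_mul _

lemma generator_eq_sum {f : Config d → ℝ} {X : Finset (Site d)}
    (hf : DependsOn f (X : Set (Site d))) (σ : Config d) :
    generator c f σ = ∑ x ∈ X, c x σ * (f (flip x σ) - f σ) := by
  refine tsum_eq_sum fun x hx => ?_
  rw [hf (x := flip x σ) (y := σ) fun y hy => flip_of_ne ?_ σ, sub_self, mul_zero]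
  rintro rfl
  exact hx hy

/-- The convergence of the difference quotients to the generator is uniform over the functions
of the spins in a fixed finite set with a given bound, since these span a finite-dimensional
space. -/
lemma IsSpinFlipProcess.eventually_abs_expect_sub_le (hP : IsSpinFlipProcess c P)
    (Y : Finset (Site d)) (F : ℝ) {δ : ℝ} (hδ : 0 < δ) :
    ∀ᶠ s in 𝓝 (0 : ℝ≥0), ∀ g : Config d → ℝ, DependsOn g (Y : Set (Site d)) →
      (∀ σ, |g σ| ≤ F) → ∀ σ, |expect P s g σ - g σ - s * generator c g σ| ≤ s * δ := by
  classical
  set e : (Y → ℤˣ) → Config d → ℝ := fun ξ σ => if (fun y : Y => σ y) = ξ then 1 else 0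
  have hedep : ∀ ξ, DependsOn (e ξ) (Y : Set (Site d)) := by
    intro ξ σ τ hst
    have : (fun y : Y => σ y) = fun y : Y => τ y := funext fun y => hst y y.2
    simp only [e, this]
  have hecont : ∀ ξ, Continuous (e ξ) := fun ξ => continuous_of_dependsOn (hedep ξ)
  set N : ℝ := (Fintype.card (Y → ℤˣ) : ℝ)
  have hN : 0 < N := by
    have : 0 < Fintype.card (Y → ℤˣ) := Fintype.card_pos
    exact Nat.cast_pos.2 this
  set δ' := δ / (N * (|F| + 1))
  have hδ' : 0 < δ' := by positivity
  have hev : ∀ᶠ s in 𝓝[>] (0 : ℝ≥0), ∀ ξ, ∀ σ,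
      |expect P s (e ξ) σ - e ξ σ - s * generator c (e ξ) σ| ≤ s * δ' := by
    rw [eventually_all]
    intro ξ
    have := Metric.tendstoUniformly_iff.1 (hP.generator_eq (e ξ) ⟨Y, hedep ξ⟩) δ' hδ'
    filter_upwards [this, self_mem_nhdsWithin] with s hs hs0 σ
    have hs0' : (0 : ℝ) < s := by exact_mod_cast hs0
    have h1 := hs σ
    rw [dist_comm, Real.dist_eq] at h1
    have : expect P s (e ξ) σ - e ξ σ - s * generator c (e ξ) σ =
        s * ((s : ℝ)⁻¹ * (expect P s (e ξ) σ - e ξ σ) - generator c (e ξ) σ) := by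
      field_simp
    rw [this, abs_mul, abs_of_pos hs0']
    exact mul_le_mul_of_nonneg_left h1.le hs0'.le
  rw [eventually_nhdsWithin_iff] at hev
  filter_upwards [hev] with s hs g hg hgF σ
  rcases eq_or_ne s 0 with rfl | hs0
  · simp [hP.expect_zero (continuous_of_dependsOn hg)]
  replace hs := hs (pos_iff_ne_zero.2 hs0)
  set a : (Y → ℤˣ) → ℝ := fun ξ => g fun y => if hy : y ∈ Y then ξ ⟨y, hy⟩ else 1
  have hga : g = fun σ => ∑ ξ, a ξ * e ξ σ := by
    ext σ
    simp only [e, mul_ite, mul_one, mul_zero, Finset.sum_ite_eq, Finset.mem_univ, if_true, a]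
    exact hg fun y hy => by simp [Finset.mem_coe.1 hy]
  have hgen : generator c g σ = ∑ ξ, a ξ * generator c (e ξ) σ := by
    rw [generator_eq_sum hg]
    simp only [generator_eq_sum (hedep _), Finset.mul_sum]
    rw [Finset.sum_comm]
    refine Finset.sum_congr rfl fun x _ => ?_
    rw [hga]
    simp only
    rw [← Finset.sum_sub_distrib, Finset.mul_sum]
    exact Finset.sum_congr rfl fun ξ _ => by ring
  have hexp : expect P s g σ = ∑ ξ, a ξ * expect P s (e ξ) σ := by
    conv_lhs => rw [hga]
    exact hP.expect_sum s _ a hecont σ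
  have hgs : g σ = ∑ ξ, a ξ * e ξ σ := congrFun hga σ
  have : expect P s g σ - g σ - s * generator c g σ =
      ∑ ξ, a ξ * (expect P s (e ξ) σ - e ξ σ - s * generator c (e ξ) σ) := by
    rw [hexp, hgen, hgs, Finset.mul_sum, ← Finset.sum_sub_distrib, ← Finset.sum_sub_distrib]
    exact Finset.sum_congr rfl fun ξ _ => by ring
  rw [this]
  calc _ ≤ ∑ ξ : Y → ℤˣ, (|F| + 1) * (s * δ') := by
        refine (Finset.abs_sum_le_sum_abs _ _).trans (Finset.sum_le_sum fun ξ _ => ?_)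
        rw [abs_mul]
        refine mul_le_mul ?_ (hs ξ σ) (abs_nonneg _) (by positivity)
        exact (hgF _).trans ((le_abs_self F).trans (by linarith))
    _ = s * δ := by
        rw [Finset.sum_const, nsmul_eq_mul, Finset.card_univ]
        change N * _ = _
        simp only [δ']
        field_simp

end expect

/-! ### Approximation of the process by the discretized finite-volume dynamics -/

/-- The heat-bath form of the rates `c`: if each spin is resampled at rate `κ`, and becomes `1` with
probability `heatBath κ c x σ`, then the spin at `x` flips with rate `c x σ`. -/
noncomputable def heatBath (κ : ℝ) (c : Site d → Config d → ℝ) (x : Site d) (σ : Config d) : ℝ :=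
  if σ x = 1 then 1 - c x σ / κ else c x σ / κ

section heatBath

variable {c : Site d → Config d → ℝ} {κ : ℝ} {r : ℕ}

lemma resample_heatBath (x : Site d) (f : Config d → ℝ) (σ : Config d) :
    resample (heatBath κ c) x f σ - f σ = κ⁻¹ * (c x σ * (f (flip x σ) - f σ)) := by
  have e' : (-1 : ℤˣ) ≠ 1 := by decide
  rw [resample_apply, heatBath, flip]
  rcases Int.units_eq_one_or (σ x) with h | h
  · have : Function.update σ x 1 = σ := by rw [← h, Function.update_eq_self]
    rw [if_pos h, this, h]; ring
  · have : Function.update σ x (-1) = σ := by rw [← h, Function.update_eq_self]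
    rw [if_neg (by rw [h]; exact e'), this, h, neg_neg]; ring

lemma step_heatBath (hκ : 0 < κ) (Λ : Finset (Site d)) (s : ℝ) (f : Config d → ℝ) (σ : Config d) :
    step (heatBath κ c) Λ (κ * s) f σ =
      f σ + s * ∑ x ∈ Λ, c x σ * (f (flip x σ) - f σ) := by
  rw [step_apply]
  simp only [resample_heatBath, ← Finset.mul_sum]
  field_simp

lemma isProb_heatBath (hc : IsRates r c) (hκ : 0 < κ) (hle : ∀ x σ, c x σ ≤ κ) :
    IsProb (heatBath κ c) := by
  intro x σ
  have h1 : 0 ≤ c x σ / κ := div_nonneg (hc.nonneg x σ) hκ.le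
  have h2 : c x σ / κ ≤ 1 := (div_le_one hκ).2 (hle x σ)
  unfold heatBath
  split_ifs <;> constructor <;> linarith

lemma dependsOn_heatBath (hc : IsRates r c) (x : Site d) :
    DependsOn (heatBath κ c x) (ball r x) := by
  intro σ τ h
  have hx : σ x = τ x := h x (by simp [ball])
  simp only [heatBath, hx, hc.finite_range x h]

/-- For a resampling rate of at least twice the maximal flip rate, the heat-bath probabilities of
attractive rates are increasing. -/
lemma monotone_heatBath (hattr : Attractive c) (hκ : 0 < κ)
    (hle : ∀ x σ, 2 * c x σ ≤ κ) (x : Site d) : Monotone (heatBath κ c x) := by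
  intro σ τ hστ
  have e' : (-1 : ℤˣ) ≠ 1 := by decide
  have hx : σ x ≤ τ x := hστ x
  have hhalf : ∀ ξ, c x ξ / κ ≤ 1 / 2 := fun ξ => by
    rw [div_le_iff₀ hκ]; linarith [hle x ξ]
  unfold heatBath
  rcases Int.units_eq_one_or (σ x) with h | h <;> rcases Int.units_eq_one_or (τ x) with h' | h'
  · rw [if_pos h, if_pos h']
    have := (hattr τ σ hστ x).2 h' h
    gcongr
  · rw [h, h'] at hx; exact absurd hx (by decide)
  · rw [if_neg (by rw [h]; exact e'), if_pos h']
    linarith [hhalf σ, hhalf τ]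
  · rw [if_neg (by rw [h]; exact e'), if_neg (by rw [h']; exact e')]
    have := (hattr τ σ hστ x).1 h' h
    gcongr

lemma dependsOn_step {p : Site d → Config d → ℝ} (hr : ∀ x, DependsOn (p x) (ball r x))
    {Λ V : Finset (Site d)} (hV : ∀ z ∈ Λ, ballFinset r z ⊆ V) {h : ℝ} {f : Config d → ℝ}
    (hf : DependsOn f (V : Set (Site d))) : DependsOn (step p Λ h f) (V : Set (Site d)) := by
  intro σ τ hst
  rw [step_apply, step_apply, hf hst]
  congr 2
  refine Finset.sum_congr rfl fun x hx => ?_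
  have hupd : ∀ a, f (Function.update σ x a) = f (Function.update τ x a) := fun a => hf fun y hy => by
    by_cases hyx : y = x
    · subst hyx; simp
    · simp [hyx, hst y hy]
  rw [resample_apply, resample_apply, hupd, hupd,
    hr x fun y hy => hst y (hV x hx (mem_ballFinset.2 hy))]

lemma dependsOn_step_pow {p : Site d → Config d → ℝ} (hr : ∀ x, DependsOn (p x) (ball r x))
    {Λ V : Finset (Site d)} (hV : ∀ z ∈ Λ, ballFinset r z ⊆ V) {h : ℝ} {f : Config d → ℝ}
    (hf : DependsOn f (V : Set (Site d))) (n : ℕ) :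
    DependsOn ((step p Λ h ^ n) f) (V : Set (Site d)) := by
  induction n with
  | zero => simpa
  | succ n ih =>
    rw [pow_succ', Module.End.mul_apply]
    exact dependsOn_step hr hV ih

lemma abs_step_pow_flip_sub_le {p : Site d → Config d → ℝ} (hp : IsProb p)
    (hr : ∀ x, DependsOn (p x) (ball r x)) {Λ X : Finset (Site d)} {h : ℝ} (h0 : 0 ≤ h)
    (h1 : h * Λ.card ≤ 1) {f : Config d → ℝ} (hf : DependsOn f (X : Set (Site d))) (n : ℕ)
    (z : Site d) (σ : Config d) :
    |(step p Λ h ^ n) f (flip z σ) - (step p Λ h ^ n) f σ| ≤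
      ∑ x ∈ X, osc f x * (Real.exp (n * h * speed d r) * Real.exp (-2 * dist₁ x z)) := by
  refine (abs_step_pow_sub_le hp h0 h1 (abs_sub_le_of_dependsOn hf) n _ _).trans ?_
  simp only [map_sum, map_smul, Finset.sum_apply, Pi.smul_apply, smul_eq_mul]
  exact Finset.sum_le_sum fun x _ => mul_le_mul_of_nonneg_left
    (pairStep_pow_disc_le hp hr h0 h1 n x z fun y hy => flip_of_ne hy σ) (osc_nonneg f x)

/-- One step of length `s`, in a volume that contains all but a small part of the dependence
of `g`, approximates the process up to an error `o(s)`. -/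
lemma abs_expect_sub_step_le {P : ℝ≥0 → Kernel (Config d) (Config d)} (hc : IsRates r c)
    (hκ : 0 < κ) (hle : ∀ x σ, c x σ ≤ κ) {Λ V : Finset (Site d)} (hΛV : Λ ⊆ V) {s : ℝ≥0}
    {g : Config d → ℝ} (hg : DependsOn g (V : Set (Site d))) {δ δ' : ℝ} {σ : Config d}
    (hgen : |expect P s g σ - g σ - s * generator c g σ| ≤ s * δ) {G : Site d → ℝ}
    (hG : ∀ z, |g (flip z σ) - g σ| ≤ G z) (hGsum : ∑ z ∈ V \ Λ, G z ≤ δ') :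
    |expect P s g σ - step (heatBath κ c) Λ (κ * s) g σ| ≤ s * (δ + κ * δ') := by
  classical
  rw [step_heatBath hκ]
  have hsplit : generator c g σ - ∑ x ∈ Λ, c x σ * (g (flip x σ) - g σ) =
      ∑ x ∈ V \ Λ, c x σ * (g (flip x σ) - g σ) := by
    rw [generator_eq_sum hg, ← Finset.sum_sdiff hΛV]; ring
  have hdiff : |generator c g σ - ∑ x ∈ Λ, c x σ * (g (flip x σ) - g σ)| ≤ κ * δ' := by
    rw [hsplit]
    calc _ ≤ ∑ x ∈ V \ Λ, κ * G x := by
          refine (Finset.abs_sum_le_sum_abs _ _).trans (Finset.sum_le_sum fun x _ => ?_)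
          rw [abs_mul, abs_of_nonneg (hc.nonneg x σ)]
          exact mul_le_mul (hle x σ) (hG x) (abs_nonneg _) hκ.le
      _ ≤ κ * δ' := by
          rw [← Finset.mul_sum]; exact mul_le_mul_of_nonneg_left hGsum hκ.le
  calc _ = |(expect P s g σ - g σ - s * generator c g σ) +
        s * (generator c g σ - ∑ x ∈ Λ, c x σ * (g (flip x σ) - g σ))| := by congr 1; ring
    _ ≤ s * δ + s * (κ * δ') := by
        refine (abs_add_le _ _).trans (add_le_add hgen ?_)
        rw [abs_mul, abs_of_nonneg s.coe_nonneg]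
        exact mul_le_mul_of_nonneg_left hdiff s.2
    _ = _ := by ring

/-- The semigroup of the process is the limit of the discretized finite-volume dynamics, as the
time step tends to `0` and then the volume to `ℤ^d`. -/
theorem IsSpinFlipProcess.eventually_abs_expect_sub_step_pow_le
    {P : ℝ≥0 → Kernel (Config d) (Config d)} (hP : IsSpinFlipProcess c P) (hc : IsRates r c)
    (hκ : 0 < κ) (hle : ∀ x σ, c x σ ≤ κ) {f : Config d → ℝ} (hf : IsCylinder f) (t : ℝ≥0)
    {δ : ℝ} (hδ : 0 < δ) :
    ∀ᶠ Λ in (atTop : Filter (Finset (Site d))), ∀ᶠ n : ℕ in atTop, ∀ σ,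
      |expect P t f σ - (step (heatBath κ c) Λ (κ * (t / n)) ^ n) f σ| ≤ δ := by
  classical
  obtain ⟨X, hX⟩ := hf
  obtain ⟨S, -, hS⟩ := exists_sum_exp_dist₁_le d
  have hfc := continuous_of_dependsOn hX
  have hp := isProb_heatBath hc hκ hle
  have hr := fun x => dependsOn_heatBath (κ := κ) hc x
  set G : Site d → ℝ := fun z =>
    ∑ x ∈ X, osc f x * (Real.exp (κ * t * speed d r) * Real.exp (-2 * dist₁ x z))
  have hGsummable : Summable G := by
    refine summable_sum fun x _ => Summable.mul_left _ (Summable.mul_left _ ?_)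
    refine summable_of_sum_le (fun _ => (Real.exp_pos _).le) (c := S) fun V => ?_
    refine (Finset.sum_le_sum fun y _ => Real.exp_le_exp.2 ?_).trans (hS x V)
    linarith [dist₁_nonneg x y]
  set δ₁ := δ / (2 * (κ * t + 1))
  set δ₂ := δ / (2 * (t + 1))
  have hκt : 0 ≤ κ * t := mul_nonneg hκ.le t.2
  have hδ₁ : 0 < δ₁ := by positivity
  have hδ₂ : 0 < δ₂ := by positivity
  obtain ⟨Λ₀, hΛ₀⟩ := summable_iff_vanishing_norm.1 hGsummable δ₁ hδ₁
  filter_upwards [eventually_ge_atTop Λ₀] with Λ hΛ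
  set V : Finset (Site d) := X ∪ Λ ∪ Λ.biUnion (ballFinset r)
  have hXV : X ⊆ V := Finset.subset_union_left.trans Finset.subset_union_left
  have hΛV : Λ ⊆ V := Finset.subset_union_right.trans Finset.subset_union_left
  have hballV : ∀ z ∈ Λ, ballFinset r z ⊆ V := fun z hz =>
    (Finset.subset_biUnion_of_mem _ hz).trans Finset.subset_union_right
  have hGV : ∑ z ∈ V \ Λ, G z ≤ δ₁ := by
    refine (le_abs_self _).trans (hΛ₀ _ ?_).le
    exact Finset.disjoint_of_subset_right hΛ Finset.sdiff_disjoint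
  obtain ⟨F, hF⟩ := exists_abs_le hfc
  have htend : Tendsto (fun n : ℕ => t / (n : ℝ≥0)) atTop (𝓝 0) :=
    tendsto_const_div_atTop_nhds_zero_nat t
  have hcard : ∀ᶠ n : ℕ in atTop, κ * (t / n) * Λ.card ≤ 1 := by
    have h2 : Tendsto (fun n : ℕ => κ * ((t : ℝ) / n) * Λ.card) atTop (𝓝 (κ * 0 * Λ.card)) :=
      ((tendsto_const_div_atTop_nhds_zero_nat (t : ℝ)).const_mul κ).mul_const _
    rw [mul_zero, zero_mul] at h2
    filter_upwards [h2.eventually (gt_mem_nhds one_pos)] with n hn using hn.le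
  filter_upwards [htend.eventually (hP.eventually_abs_expect_sub_le V F hδ₂), hcard,
    eventually_gt_atTop 0] with n hgen h1 hn σ
  set s : ℝ≥0 := t / n
  have hsr : (s : ℝ) = t / n := by simp [s]
  rw [← hsr] at h1 ⊢
  have hn' : (n : ℝ) ≠ 0 := by exact_mod_cast hn.ne'
  have hns : (n : ℝ) * s = t := by rw [hsr]; field_simp
  have h0 : 0 ≤ κ * s := mul_nonneg hκ.le s.2
  set g : ℕ → Config d → ℝ := fun k => (step (heatBath κ c) Λ (κ * s) ^ k) f
  have hgdep : ∀ k, DependsOn (g k) (V : Set (Site d)) := fun k =>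
    dependsOn_step_pow hr hballV (hX.mono (by exact_mod_cast hXV)) k
  -- the error of a single step; the errors add up since the semigroup is a contraction
  have hone : ∀ k ≤ n, ∀ σ, |expect P s (g k) σ - g (k + 1) σ| ≤ s * (δ₂ + κ * δ₁) := by
    intro k hk σ
    have : g (k + 1) = step (heatBath κ c) Λ (κ * s) (g k) := by
      simp only [g, pow_succ', Module.End.mul_apply]
    rw [this]
    refine abs_expect_sub_step_le hc hκ hle hΛV (hgdep k)
      (hgen (g k) (hgdep k) (abs_step_pow_le hp h0 h1 hF k) σ) (fun z => ?_) hGV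
    refine (abs_step_pow_flip_sub_le hp hr h0 h1 hX k z σ).trans ?_
    refine Finset.sum_le_sum fun x _ => ?_
    have hks : (k : ℝ) * (κ * s) ≤ κ * t := by
      rw [← hns]
      have : (k : ℝ) ≤ n := by exact_mod_cast hk
      nlinarith
    have := osc_nonneg f x
    have := speed_nonneg d r
    gcongr
  have htel : ∀ k ≤ n, ∀ σ, |expect P (k * s) f σ - g k σ| ≤ k * (s * (δ₂ + κ * δ₁)) := by
    intro k
    induction k with
    | zero => intro _ σ; simp [g, hP.expect_zero hfc]
    | succ k ih =>
      intro hk σ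
      have hadd : ((k + 1 : ℕ) : ℝ≥0) * s = s + k * s := by push_cast; ring
      rw [hadd, hP.expect_add _ _ hfc]
      calc _ ≤ |expect P s (expect P (k * s) f) σ - expect P s (g k) σ| +
            |expect P s (g k) σ - g (k + 1) σ| := abs_sub_le _ _ _
        _ ≤ k * (s * (δ₂ + κ * δ₁)) + s * (δ₂ + κ * δ₁) :=
          add_le_add (hP.abs_expect_sub_le s (hP.continuous_expect _ hfc)
            (continuous_of_dependsOn (hgdep k)) (ih (by omega)) σ) (hone k (by omega) σ)
        _ = _ := by push_cast; ring
  have hfin := htel n le_rfl σ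
  have : (n : ℝ≥0) * s = t := by exact_mod_cast hns
  rw [this] at hfin
  refine hfin.trans ?_
  rw [← mul_assoc, hns]
  have e1 : t * δ₂ ≤ δ / 2 := by
    simp only [δ₂]; rw [mul_div_assoc', div_le_div_iff₀ (by positivity) (by positivity)]
    nlinarith [t.2]
  have e2 : κ * t * δ₁ ≤ δ / 2 := by
    simp only [δ₁]; rw [mul_div_assoc', div_le_div_iff₀ (by positivity) (by positivity)]
    nlinarith
  linarith

end heatBath

/-! ### Contraction at a fixed large time -/

lemma dependsOn_plus (x : Site d) : DependsOn (plus x) (({x} : Finset (Site d)) : Set (Site d)) := by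
  intro σ τ h
  have : σ x = τ x := h x (by simp)
  simp [plus, this]

lemma isCylinder_plus (x : Site d) : IsCylinder (plus x) := ⟨{x}, dependsOn_plus x⟩

lemma plus_eq_shift (x : Site d) : plus x = fun σ => plus 0 (shift x σ) := by
  ext σ
  simp [plus, shift]

/-- Exponential mixing bounds the dependence of the law of a single spin on the initial
configuration, uniformly in the position of the spin. -/
lemma ExpMixing.exists_expect_plus_sub_le {P : ℝ≥0 → Kernel (Config d) (Config d)}
    (hmix : ExpMixing P) : ∃ a C : ℝ, 0 < a ∧ 0 < C ∧ ∀ (t : ℝ≥0) (x : Site d) (σ τ : Config d),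
      expect P t (plus x) σ - expect P t (plus x) τ ≤ C * Real.exp (-(a * t)) := by
  obtain ⟨μ, -, a, ha, C, hC, hmix⟩ := hmix
  refine ⟨a, 2 * |C (plus 0)| + 1, ha, by positivity, fun t x σ τ => ?_⟩
  have hx : C (plus x) = C (plus 0) := by
    rw [plus_eq_shift]; exact hC _ (isCylinder_plus 0) x
  have h1 := (abs_le.1 (hmix (plus x) (isCylinder_plus x) t σ)).2
  have h2 := (abs_le.1 (hmix (plus x) (isCylinder_plus x) t τ)).1
  rw [hx] at h1 h2
  have hE := Real.exp_pos (-(a * (t : ℝ)))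
  have h3 := mul_le_mul_of_nonneg_right (le_abs_self (C (plus 0))) hE.le
  unfold expect
  linarith

section contraction

variable {c₀ c₁ : Site d → Config d → ℝ} {P₀ P₁ : ℝ≥0 → Kernel (Config d) (Config d)}
  {κ ε S : ℝ} {r : ℕ}

lemma abs_heatBath_sub_le (hκ : 0 < κ) (hε : ∀ x σ, |c₀ x σ - c₁ x σ| ≤ ε) (x : Site d)
    (σ : Config d) : |heatBath κ c₀ x σ - heatBath κ c₁ x σ| ≤ ε / κ := by
  have h : |c₀ x σ / κ - c₁ x σ / κ| ≤ ε / κ := by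
    rw [← sub_div, abs_div, abs_of_pos hκ]
    exact div_le_div_of_nonneg_right (hε x σ) hκ.le
  unfold heatBath
  split_ifs
  · rw [abs_sub_comm] at h
    rwa [sub_sub_sub_cancel_left]
  · exact h

/-- The influence of the spin at `y` on `𝔼 (f_t)` for the process with rates `c₁`. The contribution
of each site `x` in the support of `f` is bounded in two ways: by comparison with the attractive
process, and by the finite speed of propagation. -/
lemma abs_expect_flip_sub_le (hP₀ : IsSpinFlipProcess c₀ P₀) (hP₁ : IsSpinFlipProcess c₁ P₁)
    (hc₀ : IsRates r c₀) (hc₁ : IsRates r c₁) (hattr : Attractive c₀) (hκ : 0 < κ)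
    (hκ₀ : ∀ x σ, 2 * c₀ x σ ≤ κ) (hκ₁ : ∀ x σ, c₁ x σ ≤ κ) (hε0 : 0 ≤ ε)
    (hε : ∀ x σ, |c₀ x σ - c₁ x σ| ≤ ε)
    (hS : ∀ (x : Site d) (V : Finset (Site d)), ∑ y ∈ V, Real.exp (-dist₁ x y) ≤ S)
    (t : ℝ≥0) {θ : ℝ}
    (hθ : ∀ (x : Site d) σ τ, expect P₀ t (plus x) σ - expect P₀ t (plus x) τ ≤ θ)
    {f : Config d → ℝ} {X : Finset (Site d)} (hf : DependsOn f (X : Set (Site d))) (y : Site d)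
    (σ : Config d) :
    |expect P₁ t f (flip y σ) - expect P₁ t f σ| ≤
      ∑ x ∈ X, osc f x * min (θ + 2 * t * ε * (Real.exp (κ * t * speed d r) * S))
        (Real.exp (κ * t * speed d r) * Real.exp (-2 * dist₁ x y)) := by
  have hκ₀' : ∀ x σ, c₀ x σ ≤ κ := fun x σ => by linarith [hκ₀ x σ, hc₀.nonneg x σ]
  have hp₀ := isProb_heatBath hc₀ hκ hκ₀'
  have hp₁ := isProb_heatBath hc₁ hκ hκ₁
  have hr₀ := fun x => dependsOn_heatBath (κ := κ) hc₀ x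
  have hr₁ := fun x => dependsOn_heatBath (κ := κ) hc₁ x
  refine le_of_forall_pos_le_add fun δ hδ => ?_
  set A := ∑ x ∈ X, osc f x
  have hA : 0 ≤ A := Finset.sum_nonneg fun x _ => osc_nonneg f x
  set δ' := δ / (2 * (1 + A))
  have hδ' : 0 < δ' := by positivity
  have ev₁ := hP₁.eventually_abs_expect_sub_step_pow_le hc₁ hκ hκ₁ ⟨X, hf⟩ t hδ'
  have ev₀ : ∀ᶠ Λ in (atTop : Filter (Finset (Site d))), ∀ x ∈ X, ∀ᶠ n : ℕ in atTop, ∀ σ,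
      |expect P₀ t (plus x) σ - (step (heatBath κ c₀) Λ (κ * (t / n)) ^ n) (plus x) σ| ≤ δ' :=
    (eventually_all_finset X).2 fun x _ =>
      hP₀.eventually_abs_expect_sub_step_pow_le hc₀ hκ hκ₀' (isCylinder_plus x) t hδ'
  obtain ⟨Λ, hΛ₁, hΛ₀⟩ := (ev₁.and ev₀).exists
  have hcard : ∀ᶠ n : ℕ in atTop, κ * (t / n) * Λ.card ≤ 1 := by
    have h2 : Tendsto (fun n : ℕ => κ * ((t : ℝ) / n) * Λ.card) atTop (𝓝 (κ * 0 * Λ.card)) :=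
      ((tendsto_const_div_atTop_nhds_zero_nat (t : ℝ)).const_mul κ).mul_const _
    rw [mul_zero, zero_mul] at h2
    filter_upwards [h2.eventually (gt_mem_nhds one_pos)] with n hn using hn.le
  obtain ⟨n, hn₁, hn₀, h1, hn⟩ := (hΛ₁.and (((eventually_all_finset X).2 hΛ₀).and
    (hcard.and (eventually_gt_atTop 0)))).exists
  set h := κ * ((t : ℝ) / n) with hh
  have h0 : 0 ≤ h := by positivity
  have hn' : (n : ℝ) ≠ 0 := by exact_mod_cast hn.ne'
  have hnh : (n : ℝ) * h = κ * t := by rw [hh]; field_simp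
  have hpair : ∀ x ∈ X, (pairStep (heatBath κ c₁) Λ h ^ n) (disc x) (flip y σ) σ ≤
      min (θ + 2 * t * ε * (Real.exp (κ * t * speed d r) * S))
        (Real.exp (κ * t * speed d r) * Real.exp (-2 * dist₁ x y)) + 2 * δ' := by
    intro x hx
    rw [← min_add_add_right]
    refine le_min ?_ ?_
    · have key := pairStep_pow_disc_le_attractive hp₀ hr₀ hp₁
        (monotone_heatBath hattr hκ hκ₀) (abs_heatBath_sub_le hκ hε) (div_nonneg hε0 hκ.le) h0 h1
        hS n x (flip y σ) σ
      have b1 := abs_le.1 (hn₀ x hx (flip y σ ⊔ σ))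
      have b2 := abs_le.1 (hn₀ x hx (flip y σ ⊓ σ))
      have b3 := hθ x (flip y σ ⊔ σ) (flip y σ ⊓ σ)
      rw [hnh] at key
      have e : 2 * (κ * t) * (ε / κ) = 2 * t * ε := by field_simp
      rw [e] at key
      linarith [b1.1, b2.2]
    · have key := pairStep_pow_disc_le hp₁ hr₁ h0 h1 n x y (σ := flip y σ) (τ := σ)
        fun z hz => flip_of_ne hz σ
      rw [hnh] at key
      linarith
  have hstep := abs_step_pow_sub_le hp₁ h0 h1 (abs_sub_le_of_dependsOn hf) n (flip y σ) σ
  simp only [map_sum, map_smul, Finset.sum_apply, Pi.smul_apply, smul_eq_mul] at hstep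
  have hsum := hstep.trans (Finset.sum_le_sum fun x hx =>
    mul_le_mul_of_nonneg_left (hpair x hx) (osc_nonneg f x))
  simp only [mul_add, Finset.sum_add_distrib, ← Finset.sum_mul] at hsum
  have b1 := abs_le.1 (hn₁ (flip y σ))
  have b2 := abs_le.1 (hn₁ σ)
  have b3 := abs_le.1 hsum
  have hδA : 2 * δ' + A * (2 * δ') = δ := by simp only [δ']; field_simp
  rw [abs_le]
  constructor <;> linarith [b1.1, b1.2, b2.1, b2.2, b3.1, b3.2]

/-- For large times `m`, the influence of the spins at distance at most `b m` is small because of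
the exponential decay, and the influence of the other spins because of the finite speed of
propagation. -/
lemma exists_time {a C S : ℝ} (ha : 0 < a) (hC : 0 ≤ C) (d b : ℕ) : ∃ m : ℕ, 0 < m ∧
    (2 * (b * m : ℕ) + 1 : ℝ) ^ d * (C * Real.exp (-(a * m))) ≤ 1 / 8 ∧
    Real.exp (-m) * S ≤ 1 / 4 := by
  have hq : ∀ a : ℝ, 0 < a → |Real.exp (-a)| < 1 := fun a ha => by
    rw [abs_of_pos (Real.exp_pos _), Real.exp_lt_one_iff]; linarith
  have t1 : Tendsto (fun m : ℕ => (2 * b + 1 : ℝ) ^ d * C * ((m : ℝ) ^ d * Real.exp (-a) ^ m))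
      atTop (𝓝 ((2 * b + 1 : ℝ) ^ d * C * 0)) :=
    (tendsto_pow_const_mul_const_pow_of_abs_lt_one d (hq a ha)).const_mul _
  have t2 : Tendsto (fun m : ℕ => Real.exp (-1) ^ m * S) atTop (𝓝 (0 * S)) :=
    (tendsto_pow_atTop_nhds_zero_of_abs_lt_one (hq 1 one_pos)).mul_const _
  rw [mul_zero] at t1
  rw [zero_mul] at t2
  obtain ⟨m, h1, h2, hm⟩ := ((t1.eventually (gt_mem_nhds (by norm_num : (0 : ℝ) < 1 / 8))).and
    ((t2.eventually (gt_mem_nhds (by norm_num : (0 : ℝ) < 1 / 4))).and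
      (eventually_gt_atTop 0))).exists
  refine ⟨m, hm, ?_, ?_⟩
  · refine le_trans ?_ h1.le
    have hm1 : (1 : ℝ) ≤ m := by exact_mod_cast hm
    have e : Real.exp (-(a * m)) = Real.exp (-a) ^ m := by
      rw [← Real.exp_nat_mul]; congr 1; ring
    rw [e]
    calc (2 * (b * m : ℕ) + 1 : ℝ) ^ d * (C * Real.exp (-a) ^ m)
        ≤ ((2 * b + 1) * m : ℝ) ^ d * (C * Real.exp (-a) ^ m) := by
          have := Real.exp_pos (-a)
          gcongr
          push_cast
          nlinarith
      _ = _ := by rw [mul_pow]; ring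
  · refine le_trans (le_of_eq ?_) h2.le
    rw [← Real.exp_nat_mul]; congr 2; ring

/-- At a suitable time, for all rates close to `c₀`, the total influence of all sites on one site is
at most `1 / 2`. -/
lemma exists_time_influence (hc₀ : IsRates r c₀) (hattr : Attractive c₀)
    (hP₀ : IsSpinFlipProcess c₀ P₀) (hmix : ExpMixing P₀) :
    ∃ t : ℝ≥0, 0 < t ∧ ∃ ε : ℝ, 0 < ε ∧ ∃ γ : Site d → Site d → ℝ,
      (∀ x (V : Finset (Site d)), ∑ y ∈ V, γ x y ≤ 1 / 2) ∧
      ∀ c₁ : Site d → Config d → ℝ, IsRates r c₁ → (∀ x σ, |c₀ x σ - c₁ x σ| ≤ ε) →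
        ∀ P₁ : ℝ≥0 → Kernel (Config d) (Config d), IsSpinFlipProcess c₁ P₁ →
          ∀ (f : Config d → ℝ) (X : Finset (Site d)), DependsOn f (X : Set (Site d)) →
            ∀ y σ, |expect P₁ t f (flip y σ) - expect P₁ t f σ| ≤ ∑ x ∈ X, osc f x * γ x y := by
  classical
  obtain ⟨K, hK⟩ := hc₀.bounded
  have hK0 : 0 ≤ K := (hc₀.nonneg 0 1).trans (hK 0 1)
  obtain ⟨a, C, ha, hC, hdecay⟩ := hmix.exists_expect_plus_sub_le
  obtain ⟨S, hSpos, hS⟩ := exists_sum_exp_dist₁_le d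
  -- twice a common bound for `c₀` and, since `ε ≤ 1` below, for all admissible `c₁`
  set κ : ℝ := 2 * (K + 1)
  have hκ : 0 < κ := by positivity
  -- beyond distance `b m`, half of the decay `e^{-2 |x - y|}` beats the growth up to time `m`
  -- by a factor `e^{-m}`
  obtain ⟨b, hb⟩ := exists_nat_ge (κ * speed d r + 1)
  obtain ⟨m, hm, hnear, hfar⟩ := exists_time (C := C) (S := S) ha hC.le d b
  set R := b * m
  set E := Real.exp (κ * m * speed d r)
  have hE : 0 < E := Real.exp_pos _
  set N : ℝ := (2 * (R : ℝ) + 1) ^ d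
  have hN : 0 < N := by positivity
  set ε : ℝ := min 1 (1 / (8 * N * (2 * m * (E * S) + 1)))
  have hε : 0 < ε := by positivity
  set θ := C * Real.exp (-(a * m))
  refine ⟨m, by exact_mod_cast hm, ε, hε, fun x y =>
    min (θ + 2 * m * ε * (E * S)) (E * Real.exp (-2 * dist₁ x y)), fun x V => ?_, ?_⟩
  · have hθ' : N * (θ + 2 * m * ε * (E * S)) ≤ 1 / 4 := by
      have h1 : ε ≤ 1 / (8 * N * (2 * m * (E * S) + 1)) := min_le_right _ _
      rw [le_div_iff₀ (by positivity)] at h1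
      have h2 : 0 ≤ ε * N := by positivity
      linarith
    have hθ0 : 0 ≤ θ + 2 * m * ε * (E * S) := by positivity
    rw [← Finset.sum_filter_add_sum_filter_not V (· ∈ ballFinset R x)]
    have s1 : ∑ y ∈ V.filter (· ∈ ballFinset R x),
        min (θ + 2 * m * ε * (E * S)) (E * Real.exp (-2 * dist₁ x y)) ≤ 1 / 4 := by
      refine (Finset.sum_le_card_nsmul _ _ _ fun y _ => min_le_left _ _).trans ?_
      rw [nsmul_eq_mul]
      refine le_trans (mul_le_mul_of_nonneg_right ?_ hθ0) hθ'
      have : (V.filter (· ∈ ballFinset R x)).card ≤ (ballFinset R x).card :=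
        Finset.card_le_card fun z hz => (Finset.mem_filter.1 hz).2
      rw [card_ballFinset] at this
      simp only [N]
      exact_mod_cast this
    have s2 : ∑ y ∈ V.filter (· ∉ ballFinset R x),
        min (θ + 2 * m * ε * (E * S)) (E * Real.exp (-2 * dist₁ x y)) ≤ 1 / 4 := by
      calc _ ≤ ∑ y ∈ V.filter (· ∉ ballFinset R x), Real.exp (-m) * Real.exp (-dist₁ x y) := by
            refine Finset.sum_le_sum fun y hy => (min_le_right _ _).trans ?_
            have hy' := lt_dist₁_of_notMem_ball fun hy' =>
              (Finset.mem_filter.1 hy).2 (mem_ballFinset.2 hy')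
            rw [← Real.exp_add, ← Real.exp_add, Real.exp_le_exp]
            simp only [R] at hy'
            push_cast at hy'
            have hm0 : (0 : ℝ) ≤ m := m.cast_nonneg
            nlinarith [mul_le_mul_of_nonneg_right hb hm0]
        _ ≤ Real.exp (-m) * S := by
            rw [← Finset.mul_sum]
            exact mul_le_mul_of_nonneg_left (hS _ _) (Real.exp_pos _).le
        _ ≤ 1 / 4 := hfar
    linarith
  · intro c₁ hc₁ hclose P₁ hP₁ f X hf y σ
    have := abs_expect_flip_sub_le (t := m) (θ := θ) hP₀ hP₁ hc₀ hc₁ hattr hκ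
      (fun x σ => by linarith [hK x σ]) (fun x σ => ?_) hε.le hclose hS
      (fun x σ τ => by simpa using hdecay m x σ τ) hf y σ
    · simpa using this
    · have h1 := (abs_le.1 (hclose x σ)).1
      have h2 : ε ≤ 1 := min_le_left _ _
      simp only [κ]
      linarith [hK x σ]

end contraction

/-! ### Total oscillation -/

/-- The total oscillation `∑ x, osc f x` is at most `A`. -/
def TotalOscLE (f : Config d → ℝ) (A : ℝ) : Prop := ∀ V : Finset (Site d), ∑ x ∈ V, osc f x ≤ A

lemma TotalOscLE.nonneg {f : Config d → ℝ} {A : ℝ} (hA : TotalOscLE f A) : 0 ≤ A := by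
  simpa using hA ∅

lemma tendsto_piecewise (σ τ : Config d) :
    Tendsto (fun V : Finset (Site d) => V.piecewise σ τ) atTop (𝓝 σ) := by
  refine tendsto_pi_nhds.2 fun y => tendsto_const_nhds.congr' ?_
  filter_upwards [eventually_ge_atTop {y}] with V hV
  exact (Finset.piecewise_eq_of_mem _ _ _ (hV (Finset.mem_singleton_self y))).symm

/-- The total oscillation bounds the oscillation of a continuous function. -/
lemma TotalOscLE.abs_sub_le {f : Config d → ℝ} {A : ℝ} (hA : TotalOscLE f A) (hf : Continuous f)
    (σ τ : Config d) : |f σ - f τ| ≤ A := by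
  have ht : Tendsto (fun V : Finset (Site d) => |f (V.piecewise σ τ) - f τ|) atTop
      (𝓝 |f σ - f τ|) :=
    (((hf.tendsto σ).comp (tendsto_piecewise σ τ)).sub_const _).abs
  refine le_of_tendsto' ht fun V => (abs_piecewise_sub_le hf V σ τ).trans (le_trans ?_ (hA V))
  refine Finset.sum_le_sum fun x _ => mul_le_of_le_one_right (osc_nonneg f x) ?_
  unfold disc; split_ifs <;> norm_num

lemma exists_osc_eq {f : Config d → ℝ} (hf : Continuous f) (x : Site d) :
    ∃ σ, osc f x = |f (flip x σ) - f σ| := by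
  have hflip : Continuous (flip x : Config d → Config d) :=
    continuous_id.update x ((continuous_apply x).neg)
  obtain ⟨σ, -, hσ⟩ := isCompact_univ.exists_isMaxOn (Set.univ_nonempty (α := Config d))
    ((hf.comp hflip).sub hf).abs.continuousOn
  exact ⟨σ, le_antisymm (osc_le fun τ => hσ (Set.mem_univ τ)) (le_osc hf x σ)⟩

lemma osc_eq_zero_of_dependsOn {f : Config d → ℝ} {X : Finset (Site d)}
    (hf : DependsOn f (X : Set (Site d))) {x : Site d} (hx : x ∉ X) : osc f x = 0 := by
  refine le_antisymm (osc_le fun σ => ?_) (osc_nonneg f x)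
  rw [hf (x := flip x σ) (y := σ) fun y hy => flip_of_ne (by rintro rfl; exact hx hy) σ, sub_self,
    abs_zero]

lemma totalOscLE_of_dependsOn {f : Config d → ℝ} {X : Finset (Site d)}
    (hf : DependsOn f (X : Set (Site d))) : TotalOscLE f (∑' x, osc f x) := by
  intro V
  have : Summable (osc f) := summable_of_ne_finset_zero (s := X) fun x hx =>
    osc_eq_zero_of_dependsOn hf hx
  exact this.sum_le_tsum V fun x _ => osc_nonneg f x

lemma osc_comp_shift (f : Config d → ℝ) (x y : Site d) :
    osc (fun σ => f (shift x σ)) y = osc f (y - x) := by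
  have hflip : ∀ σ : Config d, shift x (flip y σ) = flip (y - x) (shift x σ) := by
    intro σ
    ext1 z
    by_cases hz : z = y - x
    · subst hz; simp [shift, flip]
    · have : z + x ≠ y := fun h => hz (eq_sub_of_add_eq h)
      simp [shift, flip, hz, this]
  have hsurj : Function.Surjective (shift x : Config d → Config d) := fun τ =>
    ⟨shift (-x) τ, by ext1 z; simp [shift]⟩
  simp only [osc, hflip]
  exact hsurj.iSup_comp (g := fun τ => |f (flip (y - x) τ) - f τ|)

lemma tsum_osc_comp_shift (f : Config d → ℝ) (x : Site d) :
    ∑' y, osc (fun σ => f (shift x σ)) y = ∑' y, osc f y := by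
  simp only [osc_comp_shift]
  exact (Equiv.subRight x).tsum_eq (osc f)

/-- The cylinder function obtained from `f` by setting the spins outside `W` to `1`. -/
noncomputable def truncate (f : Config d → ℝ) (W : Finset (Site d)) (σ : Config d) : ℝ :=
  f (W.piecewise σ 1)

lemma dependsOn_truncate (f : Config d → ℝ) (W : Finset (Site d)) :
    DependsOn (truncate f W) (W : Set (Site d)) := by
  intro σ τ h
  have : W.piecewise σ 1 = W.piecewise τ (1 : Config d) := by
    ext1 y
    by_cases hy : y ∈ W
    · simp [hy, h y hy]
    · simp [hy]
  simp only [truncate, this]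

lemma osc_truncate_le {f : Config d → ℝ} (hf : Continuous f) {W : Finset (Site d)} {x : Site d}
    (hx : x ∈ W) : osc (truncate f W) x ≤ osc f x := by
  refine osc_le fun σ => ?_
  have : W.piecewise (flip x σ) 1 = flip x (W.piecewise σ 1) := by
    ext1 y
    by_cases hy : y = x
    · subst hy; simp [flip, hx]
    · rw [flip_of_ne hy]
      by_cases hyW : y ∈ W <;> simp [hyW, flip_of_ne hy]
  simp only [truncate, this]
  exact le_osc hf x _

lemma tendsto_integral_truncate {f : Config d → ℝ} (hf : Continuous f) (μ : Measure (Config d))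
    [IsFiniteMeasure μ] :
    Tendsto (fun W => ∫ σ, truncate f W σ ∂μ) atTop (𝓝 (∫ σ, f σ ∂μ)) := by
  obtain ⟨B, hB⟩ := exists_abs_le hf
  refine tendsto_integral_filter_of_dominated_convergence (fun _ => B)
    (Eventually.of_forall fun W =>
      (continuous_of_dependsOn (dependsOn_truncate f W)).aestronglyMeasurable)
    (Eventually.of_forall fun W => Eventually.of_forall fun σ => hB _) (integrable_const B)
    (Eventually.of_forall fun σ => (hf.tendsto σ).comp (tendsto_piecewise σ 1))

lemma ext_of_forall_cylinder {μ ν : Measure (Config d)} [IsFiniteMeasure μ] [IsFiniteMeasure ν]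
    (h : ∀ f : Config d → ℝ, IsCylinder f → ∫ σ, f σ ∂μ = ∫ σ, f σ ∂ν) : μ = ν := by
  refine ext_of_forall_integral_eq_of_IsFiniteMeasure fun f => ?_
  refine tendsto_nhds_unique (tendsto_integral_truncate f.continuous μ) ?_
  simp only [h _ ⟨_, dependsOn_truncate f _⟩]
  exact tendsto_integral_truncate f.continuous ν

section decay

variable {c : Site d → Config d → ℝ} {P : ℝ≥0 → Kernel (Config d) (Config d)}

/-- If the total influence of all sites on one site at time `t` is at most `1 / 2`, then the
semigroup at time `t` halves the total oscillation. -/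
lemma IsSpinFlipProcess.totalOscLE_expect (hP : IsSpinFlipProcess c P) {t : ℝ≥0}
    {γ : Site d → Site d → ℝ} (hγ : ∀ x (V : Finset (Site d)), ∑ y ∈ V, γ x y ≤ 1 / 2)
    (hinf : ∀ (f : Config d → ℝ) (X : Finset (Site d)), DependsOn f (X : Set (Site d)) →
      ∀ y σ, |expect P t f (flip y σ) - expect P t f σ| ≤ ∑ x ∈ X, osc f x * γ x y)
    {f : Config d → ℝ} (hf : Continuous f) {A : ℝ} (hA : TotalOscLE f A) :
    TotalOscLE (expect P t f) (A / 2) := by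
  intro V
  choose σ hσ using exists_osc_eq (hP.continuous_expect t hf)
  simp only [hσ]
  have hm := hP.markov t
  have hlim : ∀ τ, Tendsto (fun W => expect P t (truncate f W) τ) atTop (𝓝 (expect P t f τ)) :=
    fun τ => tendsto_integral_truncate hf _
  refine le_of_tendsto' (tendsto_finsetSum V fun y _ =>
    ((hlim (flip y (σ y))).sub (hlim (σ y))).abs) fun W => ?_
  calc _ ≤ ∑ y ∈ V, ∑ x ∈ W, osc (truncate f W) x * γ x y :=
        Finset.sum_le_sum fun y _ => hinf _ W (dependsOn_truncate f W) y _
    _ = ∑ x ∈ W, osc (truncate f W) x * ∑ y ∈ V, γ x y := by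
        rw [Finset.sum_comm]; simp only [Finset.mul_sum]
    _ ≤ ∑ x ∈ W, osc f x * (1 / 2) := by
        refine Finset.sum_le_sum fun x hx => ?_
        exact (mul_le_mul_of_nonneg_left (hγ x V) (osc_nonneg _ x)).trans
          (mul_le_mul_of_nonneg_right (osc_truncate_le hf hx) (by norm_num))
    _ ≤ A / 2 := by
        rw [← Finset.sum_mul]; linarith [hA W]

lemma IsSpinFlipProcess.abs_expect_sub_expect_le (hP : IsSpinFlipProcess c P) (t : ℝ≥0)
    {f : Config d → ℝ} (hf : Continuous f) {b : ℝ} (hb : ∀ σ τ, |f σ - f τ| ≤ b)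
    (σ τ : Config d) : |expect P t f σ - expect P t f τ| ≤ b := by
  have hm := hP.markov t
  have h1 : ∀ η, |expect P t f σ - f η| ≤ b := fun η => by
    simpa [expect] using abs_integral_sub_le (μ := P t σ) hf (continuous_const (y := f η))
      fun ξ => hb ξ η
  simpa [expect] using abs_integral_sub_le (μ := P t τ) (continuous_const (y := expect P t f σ)) hf h1

/-- Iteration of the contraction. -/
lemma IsSpinFlipProcess.abs_expect_sub_expect_le_exp (hP : IsSpinFlipProcess c P) {t₀ : ℝ≥0}
    (ht₀ : 0 < t₀)
    (hhalf : ∀ f : Config d → ℝ, Continuous f → ∀ A, TotalOscLE f A →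
      TotalOscLE (expect P t₀ f) (A / 2))
    {f : Config d → ℝ} (hf : Continuous f) {A : ℝ} (hA : TotalOscLE f A) (t : ℝ≥0)
    (σ τ : Config d) :
    |expect P t f σ - expect P t f τ| ≤ 2 * A * Real.exp (-(Real.log 2 / t₀ * t)) := by
  have hn : ∀ n : ℕ, TotalOscLE (expect P (n * t₀) f) (A / 2 ^ n) := by
    intro n
    induction n with
    | zero =>
      have : expect P ((0 : ℕ) * t₀) f = f := by
        ext σ; rw [Nat.cast_zero, zero_mul, hP.expect_zero hf]
      rw [this, pow_zero, div_one]
      exact hA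
    | succ n ih =>
      have h1 : expect P ((n + 1 : ℕ) * t₀) f = expect P t₀ (expect P (n * t₀) f) := by
        ext σ
        rw [← hP.expect_add _ _ hf]
        congr 1
        push_cast; ring
      rw [h1, pow_succ, ← div_div]
      exact hhalf _ (hP.continuous_expect _ hf) _ ih
  set n := ⌊t / t₀⌋₊
  have hfloor : (n : ℝ≥0) ≤ t / t₀ := Nat.floor_le (zero_le)
  have hfloor' : t / t₀ < n + 1 := Nat.lt_floor_add_one _
  have hle : n * t₀ ≤ t := (le_div_iff₀ ht₀).1 hfloor
  have hsplit : t = (t - n * t₀) + n * t₀ := (tsub_add_cancel_of_le hle).symm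
  have h1 : ∀ σ, expect P t f σ = expect P (t - n * t₀) (expect P (n * t₀) f) σ := fun σ => by
    rw [← hP.expect_add _ _ hf, ← hsplit]
  rw [h1, h1]
  refine (hP.abs_expect_sub_expect_le _ (hP.continuous_expect _ hf)
    ((hn n).abs_sub_le (hP.continuous_expect _ hf)) σ τ).trans ?_
  have hr : (t : ℝ) / t₀ ≤ n + 1 := by exact_mod_cast hfloor'.le
  have hexp : (1 : ℝ) / 2 ^ (n + 1) ≤ Real.exp (-(Real.log 2 / t₀ * t)) := by
    have e : (1 : ℝ) / 2 ^ (n + 1) = Real.exp (-(Real.log 2 * (n + 1))) := by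
      rw [Real.exp_neg, Real.exp_mul, Real.exp_log two_pos, one_div]
      norm_cast
    rw [e, Real.exp_le_exp, neg_le_neg_iff]
    calc Real.log 2 / t₀ * t = Real.log 2 * (t / t₀) := by ring
      _ ≤ _ := mul_le_mul_of_nonneg_left hr (Real.log_nonneg one_le_two)
  have hA0 := hA.nonneg
  calc A / 2 ^ n = 2 * A * (1 / 2 ^ (n + 1)) := by rw [pow_succ]; field_simp
    _ ≤ _ := mul_le_mul_of_nonneg_left hexp (by positivity)

/-! ### Exponential mixing -/

lemma IsSpinFlipProcess.integral_bind (hP : IsSpinFlipProcess c P) (t : ℝ≥0)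
    (μ : Measure (Config d)) [IsProbabilityMeasure μ] {f : Config d → ℝ} (hf : Continuous f) :
    ∫ σ, f σ ∂(μ.bind (P t)) = ∫ σ, expect P t f σ ∂μ := by
  have hm := hP.markov t
  have h := Kernel.integral_comp (η := P t) (κ := Kernel.const Unit μ) (a := ()) (f := f)
    (integrable_of_continuous hf _)
  simpa [Kernel.comp_apply, expect] using h

/-- Compactness of the space of probability measures yields a stationary measure, as soon as the
process forgets its initial state. -/
lemma IsSpinFlipProcess.exists_isStationary (hP : IsSpinFlipProcess c P)
    (hforget : ∀ f : Config d → ℝ, IsCylinder f → ∃ b : ℕ → ℝ, Tendsto b atTop (𝓝 0) ∧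
      ∀ (n : ℕ) σ τ, |expect P (n : ℝ≥0) f σ - expect P (n : ℝ≥0) f τ| ≤ b n) :
    ∃ μ, IsStationary P μ := by
  let ρ : ℕ → ProbabilityMeasure (Config d) := fun n =>
    ⟨P n 1, (hP.markov n).isProbabilityMeasure 1⟩
  let U : Ultrafilter ℕ := Ultrafilter.of atTop
  have hU : (U : Filter ℕ) ≤ atTop := Ultrafilter.of_le atTop
  obtain ⟨μ, -, hμ⟩ := isCompact_univ.ultrafilter_le_nhds (U.map ρ) (by simp)
  have hlim : ∀ f : Config d → ℝ, Continuous f →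
      Tendsto (fun n : ℕ => expect P n f 1) U (𝓝 (∫ σ, f σ ∂(μ : Measure (Config d)))) :=
    fun f hf => ProbabilityMeasure.tendsto_iff_forall_integral_tendsto.1
      (show Tendsto ρ U (𝓝 μ) from hμ) (BoundedContinuousFunction.mkOfCompact ⟨f, hf⟩)
  refine ⟨μ, inferInstance, fun t => ?_⟩
  have hm := hP.markov t
  refine ext_of_forall_cylinder fun f hf => ?_
  have hfc := hf.continuous
  rw [hP.integral_bind t _ hfc]
  obtain ⟨b, hb, hbound⟩ := hforget f hf
  refine tendsto_nhds_unique (hlim _ (hP.continuous_expect t hfc)) ?_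
  -- `𝔼 (f_{n + t})` and `𝔼 (f_n)` have the same limit: what happens up to time `t` is forgotten
  have hdiff : Tendsto (fun n : ℕ => expect P n (expect P t f) 1 - expect P n f 1) U (𝓝 0) := by
    refine squeeze_zero_norm (fun n => ?_) (hb.mono_left hU)
    have hcomm : expect P n (expect P t f) 1 = expect P t (expect P n f) 1 := by
      rw [← hP.expect_add _ _ hfc, ← hP.expect_add _ _ hfc, add_comm]
    rw [hcomm, Real.norm_eq_abs]
    simpa [expect] using abs_integral_sub_le (μ := P t 1) (hP.continuous_expect n hfc)
      (continuous_const (y := expect P n f 1)) fun σ => hbound n σ 1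
  simpa using hdiff.add (hlim f hfc)

lemma IsSpinFlipProcess.expMixing (hP : IsSpinFlipProcess c P) {a : ℝ} (ha : 0 < a)
    (hdecay : ∀ f : Config d → ℝ, IsCylinder f → ∀ (t : ℝ≥0) σ τ,
      |expect P t f σ - expect P t f τ| ≤ 2 * (∑' x, osc f x) * Real.exp (-(a * t))) :
    ExpMixing P := by
  have hzero : ∀ B : ℝ, Tendsto (fun n : ℕ => B * Real.exp (-(a * n))) atTop (𝓝 0) := by
    intro B
    have h1 : Tendsto (fun n : ℕ => a * (n : ℝ)) atTop atTop :=
      tendsto_natCast_atTop_atTop.const_mul_atTop ha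
    simpa using (Real.tendsto_exp_neg_atTop_nhds_zero.comp h1).const_mul B
  have hrate : ∀ ν, IsStationary P ν → ∀ f : Config d → ℝ, IsCylinder f → ∀ (t : ℝ≥0) σ,
      |expect P t f σ - ∫ η, f η ∂ν| ≤ 2 * (∑' x, osc f x) * Real.exp (-(a * t)) := by
    intro ν hν f hf t σ
    have := hν.1
    have h1 : ∫ η, f η ∂ν = ∫ η, expect P t f η ∂ν := by
      rw [← hP.integral_bind t ν hf.continuous, hν.2 t]
    rw [h1]
    simpa using abs_integral_sub_le (μ := ν) (continuous_const (y := expect P t f σ))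
      (hP.continuous_expect t hf.continuous) fun τ => hdecay f hf t σ τ
  obtain ⟨μ, hμ⟩ := hP.exists_isStationary fun f hf =>
    ⟨_, hzero _, fun n σ τ => hdecay f hf n σ τ⟩
  refine ⟨μ, ⟨hμ, fun ν hν => ?_⟩, a, ha, fun f => 2 * ∑' x, osc f x, fun f _ x => ?_, hrate μ hμ⟩
  · have := hμ.1
    have := hν.1
    refine ext_of_forall_cylinder fun f hf => ?_
    have hlim : ∀ ν, IsStationary P ν →
        Tendsto (fun n : ℕ => expect P n f 1) atTop (𝓝 (∫ η, f η ∂ν)) := fun ν hν => by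
      rw [tendsto_iff_norm_sub_tendsto_zero]
      exact squeeze_zero (fun _ => norm_nonneg _) (fun n => hrate ν hν f hf n 1) (hzero _)
    exact tendsto_nhds_unique (hlim ν hν) (hlim μ hμ)
  · simp only [tsum_osc_comp_shift]

end decay

end SpinFlip

theorem theorem2 (d r : ℕ) (c₀ : SpinFlip.Site d → SpinFlip.Config d → ℝ)
    (hc₀ : SpinFlip.IsRates r c₀) (hattr : SpinFlip.Attractive c₀)
    (P₀ : ℝ≥0 → Kernel (SpinFlip.Config d) (SpinFlip.Config d))
    (hP₀ : SpinFlip.IsSpinFlipProcess c₀ P₀) (hmix : SpinFlip.ExpMixing P₀) :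
    ∃ ε : ℝ, 0 < ε ∧
      ∀ c₁ : SpinFlip.Site d → SpinFlip.Config d → ℝ, SpinFlip.IsRates r c₁ →
        (∀ x σ, |c₀ x σ - c₁ x σ| ≤ ε) →
        ∀ P₁ : ℝ≥0 → Kernel (SpinFlip.Config d) (SpinFlip.Config d),
          SpinFlip.IsSpinFlipProcess c₁ P₁ → SpinFlip.ExpMixing P₁ := by
  obtain ⟨t, ht, ε, hε, γ, hγ, hinf⟩ :=
    SpinFlip.exists_time_influence hc₀ hattr hP₀ hmix
  refine ⟨ε, hε, fun c₁ hc₁ hclose P₁ hP₁ => ?_⟩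
  have ht' : (0 : ℝ) < t := by exact_mod_cast ht
  refine hP₁.expMixing (a := Real.log 2 / t) (div_pos (Real.log_pos one_lt_two) ht') ?_
  intro f hf s σ τ
  obtain ⟨X, hX⟩ := hf
  exact hP₁.abs_expect_sub_expect_le_exp ht
    (fun g hg A hA => hP₁.totalOscLE_expect hγ (hinf c₁ hc₁ hclose P₁ hP₁) hg hA)
    (SpinFlip.continuous_of_dependsOn hX) (SpinFlip.totalOscLE_of_dependsOn hX) s σ τ
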